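/- Let $\Omega=(0,1)$ with Lebesgue measure $\mathfrak m$, and work in the Hilbert space $L^2(\Omega)$. Let $\phi\colon\mathbb R\to[0,\infty)$ be locally integrable, symmetric, and nonincreasing on $(0,\infty)$; put $\Phi(x)=\int_0^x\phi(y)\,dy$, $W_\Phi(x)=\int_0^x\Phi(y)\,dy$, and, for $X\in L^2(\Omega)$, $(\Phi*\rho)(X)(m)=\int_\Omega\Phi(X(m)-X(\omega))\,d\omega$, where $\rho=X_\#\mathfrak m$. Let $\mathcal K\subset L^2(\Omega)$ be the closed convex cone of (classes of) nondecreasing, right-continuous functions and $I_{\mathcal K}$ its indicator function ($0$ on $\mathcal K$, $+\infty$ elsewhere). For a functional $F\colon L^2(\Omega)\to\mathbb R\cup\{+\infty\}$, $\partial F(X)=\{Y: F(X)+\langle Y,Z-X\rangle\le F(Z)\ \forall Z\in L^2(\Omega)\}$. Let $\Omega_X$ be the set of points of $\Omega$ near which $X$ is constant, and $\mathcal H_X\subset L^2(\Omega)$ the closed subspace of functions that are constant on each interval contained in $\Omega_X$. $P_C$ is the metric projection onto a nonempty closed convex set $C\subset L^2(\Omega)$. Given $\bar X\in\mathcal K$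 and $\bar V\in L^2(\Omega)$, set $\bar\Psi=\bar V+(\Phi*\bar\rho)(\bar X)$ with $\bar\rho=\bar X_\#\mathfrak m$, $U[X]=\bar\Psi-(\Phi*\rho)(X)$, and $$\mathcal V(X)=\tfrac12\iint_{\Omega\times\Omega}W_\Phi(X(m)-X(\omega))\,d\omega\,dm-\langle\bar\Psi,X\rangle .$$ A Lagrangian solution with data $(\bar X,\bar V)$ is a curve $X\colon[0,\infty)\to\mathcal K$, absolutely continuous on every $[0,T]$ as a map into $L^2(\Omega)$, with $X_0=\bar X$ and $-\dot X_t\in\partial(\mathcal V+I_{\mathcal K})(X_t)$ for a.e. $t>0$. It is called sticky if $\Omega_{X_s}\subset\Omega_{X_t}$ whenever $0\le s\le t$. **Proposition.** Let $X$ be a sticky Lagrangian solution with data $(\bar X,\bar V)$, and write $\rho_t=X_{t\#}\mathfrak m$. Then the right-derivative $V_t=\frac{d^+}{dt}X_t$ exists in $L^2(\Omega)$ for every $t\ge0$, the map $r\mapsto(\Phi*\rho_r)(X_r)\in L^2(\Omega)$ is integrable on every bounded interval of $[0,\infty)$, and, with $\Psi_t=V_t+(\Phi*\rho_t)(X_t)$: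 1. $V_t\in\mathcal H_{X_t}$ and $\Psi_t\in\mathcal H_{X_t}$ for all $t\ge0$. 2. For $0\le s\le t$: $\Psi_s-\Psi_t\in\partial I_{\mathcal K}(X_t)$, and $\Psi_t=P_{\mathcal H_{X_t}}\Psi_s$. 3. For $0\le s\le t$: $X_t=P_{\mathcal K}\bigl(X_s+(t-s)\Psi_s-\int_s^t(\Phi*\rho_r)(X_r)\,dr\bigr)$. 4. For $t\ge0$: $V_t=P_{\mathcal H_{X_t}}U[X_t]=P_{\mathcal H_{X_t}}\bar\Psi-(\Phi*\rho_t)(X_t)$, and so $\Psi_t=P_{\mathcal H_{X_t}}\bar\Psi$. 5. For $t\ge0$: $X_t=P_{\mathcal K}\bigl(\bar X+\int_0^tU[X_s]\,ds\bigr)=P_{\mathcal K}\bigl(\bar X+t\bar\Psi-\int_0^t(\Phi*\rho_s)(X_s)\,ds\bigr)$. -/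

import Mathlib

open MeasureTheory Set Filter
open scoped Topology ENNReal

namespace EulerAlignment

/-- Lebesgue measure on the mass interval `Ω = (0,1)`. -/
noncomputable abbrev massMeasure : Measure ℝ := volume.restrict (Ioo (0 : ℝ) 1)

/-- The Hilbert space `L²(Ω)`. -/
abbrev L2 : Type := Lp ℝ 2 massMeasure

/-- A communication protocol: a nonnegative, locally integrable, symmetric and radially
nonincreasing function. The value at the origin, where `φ` may be singular, is irrelevant. -/
structure Protocol where
  φ : ℝ → ℝ
  nonneg : ∀ x, 0 ≤ φ x
  symmetric : ∀ x, φ (-x) = φ x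
  nonincreasing : AntitoneOn φ (Ioi 0)
  locallyIntegrable : LocallyIntegrable φ volume

namespace Protocol

/-- `Φ(x) = ∫₀ˣ φ`. -/
noncomputable def Phi (p : Protocol) (x : ℝ) : ℝ := ∫ y in (0 : ℝ)..x, p.φ y

/-- `W_Φ(x) = ∫₀ˣ Φ`. -/
noncomputable def W (p : Protocol) (x : ℝ) : ℝ := ∫ y in (0 : ℝ)..x, p.Phi y

theorem intervalIntegrable (p : Protocol) (a b : ℝ) : IntervalIntegrable p.φ volume a b :=
  (p.locallyIntegrable.integrableOn_isCompact isCompact_uIcc).intervalIntegrable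

theorem continuous_Phi (p : Protocol) : Continuous p.Phi :=
  intervalIntegral.continuous_primitive p.intervalIntegrable 0

theorem Phi_neg (p : Protocol) (x : ℝ) : p.Phi (-x) = - p.Phi x := by
  have h := intervalIntegral.integral_comp_neg (a := 0) (b := x) (f := p.φ)
  simp only [p.symmetric, neg_zero] at h
  unfold Phi
  rw [h, intervalIntegral.integral_symm]

theorem abs_Phi_le (p : Protocol) (x : ℝ) :
    |p.Phi x| ≤ (p.Phi 1 + p.φ 1) * (1 + |x|) := by
  have h1 : 0 ≤ p.Phi 1 := intervalIntegral.integral_nonneg zero_le_one fun u _ => p.nonneg u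
  have h2 : 0 ≤ p.φ 1 := p.nonneg 1
  have key : ∀ y, 0 ≤ y → |p.Phi y| ≤ (p.Phi 1 + p.φ 1) * (1 + y) := by
    intro y hy
    have h0 : 0 ≤ p.Phi y := intervalIntegral.integral_nonneg hy fun u _ => p.nonneg u
    rw [abs_of_nonneg h0]
    rcases le_total y 1 with h | h
    · have h3 : 0 ≤ ∫ u in y..1, p.φ u :=
        intervalIntegral.integral_nonneg h fun u _ => p.nonneg u
      have h4 : p.Phi y + ∫ u in y..1, p.φ u = p.Phi 1 :=
        intervalIntegral.integral_add_adjacent_intervals (p.intervalIntegrable _ _)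
          (p.intervalIntegrable _ _)
      nlinarith [mul_nonneg h1 hy, mul_nonneg h2 hy]
    · have h3 : ∫ u in (1 : ℝ)..y, p.φ u ≤ ∫ u in (1 : ℝ)..y, p.φ 1 := by
        refine intervalIntegral.integral_mono_on h (p.intervalIntegrable _ _) (by simp) ?_
        intro u hu
        exact p.nonincreasing (by simp) (mem_Ioi.2 (by linarith [hu.1])) hu.1
      have h4 : p.Phi 1 + ∫ u in (1 : ℝ)..y, p.φ u = p.Phi y :=
        intervalIntegral.integral_add_adjacent_intervals (p.intervalIntegrable _ _)
          (p.intervalIntegrable _ _)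
      simp only [intervalIntegral.integral_const, smul_eq_mul] at h3
      nlinarith [mul_nonneg h1 hy, mul_nonneg h2 hy]
  rcases le_total 0 x with h | h
  · simpa [abs_of_nonneg h] using key x h
  · have := key (-x) (by linarith)
    rwa [Phi_neg, abs_neg, ← abs_of_nonpos h] at this

theorem memLp_conv (p : Protocol) (X : L2) :
    MemLp (fun m => ∫ ω, p.Phi (X m - X ω) ∂massMeasure) 2 massMeasure := by
  have hX : MemLp X 2 massMeasure := Lp.memLp X
  have hX1 : Integrable X massMeasure := hX.integrable one_le_two
  set C := p.Phi 1 + p.φ 1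
  have hb : MemLp (fun m => C * (1 + |X m| + ∫ ω, |X ω| ∂massMeasure)) 2 massMeasure :=
    (((memLp_const (1 : ℝ)).add hX.abs).add (memLp_const _)).const_mul C
  refine hb.mono' ?_ (Eventually.of_forall fun m => ?_)
  · have hm : AEStronglyMeasurable (fun z : ℝ × ℝ => p.Phi (X z.1 - X z.2))
        (massMeasure.prod massMeasure) :=
      p.continuous_Phi.comp_aestronglyMeasurable
        (hX.1.comp_fst.sub hX.1.comp_snd)
    exact hm.integral_prod_right'
  · have hC : 0 ≤ C := add_nonneg
      (intervalIntegral.integral_nonneg zero_le_one fun u _ => p.nonneg u) (p.nonneg 1)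
    have hg : Integrable (fun ω => C * ((1 + |X m|) + |X ω|)) massMeasure :=
      ((integrable_const _).add hX1.abs).const_mul C
    refine (norm_integral_le_of_norm_le hg (Eventually.of_forall fun ω => ?_)).trans_eq ?_
    · refine (p.abs_Phi_le _).trans (mul_le_mul_of_nonneg_left ?_ hC)
      have := abs_sub (X m) (X ω)
      linarith
    · rw [integral_const_mul, integral_add (integrable_const _) hX1.abs]
      simp

/-- `(Φ ∗ ρ)(X) = ∫_Ω Φ(X - X(ω)) dω` as an element of `L²(Ω)`, where `ρ = X_# 𝔪`. -/
noncomputable def conv (p : Protocol) (X : L2) : L2 := (p.memLp_conv X).toLp _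

end Protocol

/-- The cone `𝒦` of nondecreasing, right-continuous functions in `L²(Ω)`. -/
def cone : Set L2 :=
  {X | ∃ f : ℝ → ℝ, MonotoneOn f (Ioo 0 1) ∧
    (∀ m ∈ Ioo (0 : ℝ) 1, ContinuousWithinAt f (Ici m) m) ∧ X =ᵐ[massMeasure] f}

/-- `Ω_X`: the points of `Ω` having a neighborhood on which `X` is (a.e.) constant. For `X ∈ 𝒦` this
is the same as constancy near `m` of the right-continuous representative. -/
def concentrated (X : L2) : Set ℝ :=
  {m | m ∈ Ioo (0 : ℝ) 1 ∧ ∃ c : ℝ, ∃ N ∈ 𝓝 m, ∀ᵐ x ∂massMeasure, x ∈ N → X x = c}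

/-- `ℋ_X`: the functions that are (a.e.) constant on every interval contained in `Ω_X`. -/
def stickySpace (X : L2) : Set L2 :=
  {U | ∀ a b : ℝ, a < b → Ioo a b ⊆ concentrated X →
    ∃ c : ℝ, ∀ᵐ x ∂massMeasure, x ∈ Ioo a b → U x = c}

/-- `Y = P_C X`: `Y` is the unique point of `C` nearest to `X`. -/
def IsProj (C : Set L2) (X Y : L2) : Prop :=
  Y ∈ C ∧ ∀ Z ∈ C, Z ≠ Y → ‖X - Y‖ < ‖X - Z‖

/-- The subdifferential `∂F(X)` of `F : L²(Ω) → ℝ ∪ {+∞}`. -/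
def subdifferential (F : L2 → EReal) (X : L2) : Set L2 :=
  {Y | ∀ Z : L2, F X + ((inner ℝ Y (Z - X) : ℝ) : EReal) ≤ F Z}

open Classical in
/-- The indicator function `I_𝒦`. -/
noncomputable def coneIndicator (X : L2) : EReal := if X ∈ cone then 0 else ⊤

/-- The natural velocity `Ψ[X, V] = V + (Φ ∗ ρ)(X)`. -/
noncomputable def naturalVelocity (p : Protocol) (X V : L2) : L2 := V + p.conv X

/-- The prescribed velocity `U[X] = Ψ̄ - (Φ ∗ ρ)(X)`. -/
noncomputable def prescribedVelocity (p : Protocol) (Ψbar X : L2) : L2 := Ψbar - p.conv X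

/-- `𝒱(X) = ½ ∬ W_Φ(X(m) - X(ω)) dω dm - ⟨Ψ̄, X⟩`. -/
noncomputable def potential (p : Protocol) (Ψbar X : L2) : ℝ :=
  (1 / 2) * (∫ m, ∫ ω, p.W (X m - X ω) ∂massMeasure ∂massMeasure) - inner ℝ Ψbar X

/-- `𝒱 + I_𝒦`. -/
noncomputable def constrainedPotential (p : Protocol) (Ψbar X : L2) : EReal :=
  (potential p Ψbar X : EReal) + coneIndicator X

/-- `L²`-gradient flow on `[0,∞)` of `𝒱 + I_𝒦`: a curve, absolutely continuous on every `[0,T]`,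
with `-Ẋ_t ∈ ∂(𝒱 + I_𝒦)(X_t)` for a.e. `t > 0`. -/
def IsGradientFlow (p : Protocol) (Ψbar : L2) (X : ℝ → L2) : Prop :=
  (∀ T : ℝ, 0 ≤ T → AbsolutelyContinuousOnInterval X 0 T) ∧
  ∀ᵐ t : ℝ, 0 < t → ∃ D : L2, HasDerivAt X D t ∧
    -D ∈ subdifferential (constrainedPotential p Ψbar) (X t)

/-- The Lagrangian solution with data `(X̄, V̄)`: the gradient flow, with values in `𝒦` and
`Ψ̄ = Ψ[X̄, V̄]`, that starts from `X̄`. -/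
structure IsLagrangianSolution (p : Protocol) (Xbar Vbar : L2) (X : ℝ → L2) : Prop where
  mem_cone : ∀ t, 0 ≤ t → X t ∈ cone
  gradientFlow : IsGradientFlow p (naturalVelocity p Xbar Vbar) X
  initial : X 0 = Xbar

/-- A Lagrangian solution is sticky if `Ω_{X_s} ⊆ Ω_{X_t}` for all `0 ≤ s ≤ t`. -/
structure IsStickyLagrangianSolution (p : Protocol) (Xbar Vbar : L2) (X : ℝ → L2) : Prop
    extends IsLagrangianSolution p Xbar Vbar X where
  sticky : ∀ s t, 0 ≤ s → s ≤ t → concentrated (X s) ⊆ concentrated (X t)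

/-- The velocity `V_t`, i.e. the right-derivative of `t ↦ X_t` at `t`. -/
noncomputable def velocity (X : ℝ → L2) (t : ℝ) : L2 := derivWithin X (Ici t) t

/-- `Ψ_t = V_t + (Φ ∗ ρ_t)(X_t)`. -/
noncomputable def naturalVelocityAt (p : Protocol) (X : ℝ → L2) (t : ℝ) : L2 :=
  naturalVelocity p (X t) (velocity X t)

end EulerAlignment

open EulerAlignment

/-! Write `P_t` for the projection onto `ℋ_{X_t}`. The gradient of `𝒱` at `X` is `Φ∗ρ(X) - Ψ̄`, so
the flow says that `Ψ̄ - Φ∗ρ(X_t) - Ẋ_t` is normal to `𝒦` at `X_t` for a.e. `t`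
(`normal_of_neg_mem_subdifferential`). Normal vectors are orthogonal to `ℋ_{X_t}`
(`inner_eq_zero_of_normal`), whereas `Φ∗ρ(X_t)` lies in `ℋ_{X_t}`, and so does `Ẋ_t`: stickiness
gives `X_r ∈ ℋ_{X_r} ⊆ ℋ_{X_t}` for `r ≥ t`, and the space is closed. Hence `Ẋ_t + Φ∗ρ(X_t) = P_t
Ψ̄` for a.e. `t`.

The map `t ↦ P_t Ψ̄` is right-continuous (`tendsto_stickyProj`), because constants and truncations
of `X_t` span a dense subspace of `ℋ_{X_t}` and truncation is continuous in `L²`. So the formula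
gives the right-derivative at every `t ≥ 0`, the normality of `Ψ̄ - P_t Ψ̄` also holds at every `t`,
and `Ψ_t = P_t Ψ̄`.

Two facts transport normality in time. `P_s` preserves the polar cone of `𝒦`
(`inner_starProjection_nonpos_of_polar`), so `Ψ_s - Ψ_t = P_s(Ψ̄ - Ψ_t)` is normal at `X_t`. A
vector normal at `X_s` is orthogonal to `ℋ_{X_s}`, which contains `X_t`, so it is normal at `X_t`
(`normal_mono`). Integrating these inequalities in time yields the two projection formulas onto `𝒦`.

All the geometry rests on the tail integrals `∫_x^1 Y = ⟨Y, step x⟩`. -/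

/-! ### Absolutely continuous curves in a Hilbert space. -/

section AbsolutelyContinuousCurves

theorem AbsolutelyContinuousOnInterval.sub_le_of_ae_deriv_le {g : ℝ → ℝ} {a b c : ℝ} (hab : a ≤ b)
    (hg : AbsolutelyContinuousOnInterval g a b)
    (hd : ∀ᵐ x, x ∈ Ioo a b → ∃ d, HasDerivAt g d x ∧ d ≤ c) :
    g b - g a ≤ c * (b - a) := by
  rw [← hg.integral_deriv_eq_sub]
  have : ∫ x in a..b, deriv g x ≤ ∫ _x in a..b, c := by
    refine intervalIntegral.integral_mono_ae_restrict hab hg.intervalIntegrable_deriv (by simp) ?_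
    rw [← restrict_Ioo_eq_restrict_Icc]
    refine (ae_restrict_iff' measurableSet_Ioo).2 ?_
    filter_upwards [hd] with x hx hxab
    obtain ⟨d, h1, h2⟩ := hx hxab
    rwa [h1.deriv]
  simpa [mul_comm] using this

variable {E : Type*} [NormedAddCommGroup E] [InnerProductSpace ℝ E]

theorem AbsolutelyContinuousOnInterval.inner_left {X : ℝ → E} {a b : ℝ}
    (hX : AbsolutelyContinuousOnInterval X a b) (Z : E) :
    AbsolutelyContinuousOnInterval (fun r => inner ℝ Z (X r)) a b := by
  refine squeeze_zero (fun t => Finset.sum_nonneg fun i _ => dist_nonneg) (fun t => ?_)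
    (by simpa using Tendsto.const_mul ‖Z‖ hX)
  rw [Finset.mul_sum]
  refine Finset.sum_le_sum fun i _ => ?_
  rw [Real.dist_eq, ← inner_sub_right, dist_eq_norm]
  exact abs_real_inner_le_norm _ _

/-- Pairing the curve with the error vector `Z` itself reduces the estimate to the scalar
fundamental theorem of calculus. -/
theorem AbsolutelyContinuousOnInterval.norm_sub_sub_smul_le {X : ℝ → E} {a b ε : ℝ} {v : E}
    (hab : a ≤ b) (hX : AbsolutelyContinuousOnInterval X a b)
    (hd : ∀ᵐ x, x ∈ Ioo a b → ∃ D, HasDerivAt X D x ∧ ‖D - v‖ ≤ ε) :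
    ‖X b - X a - (b - a) • v‖ ≤ |ε| * (b - a) := by
  set Z := X b - X a - (b - a) • v with hZ
  have h := (hX.inner_left Z).sub_le_of_ae_deriv_le (c := inner ℝ Z v + ‖Z‖ * |ε|) hab (by
    filter_upwards [hd] with x hx hxab
    obtain ⟨D, h1, h2⟩ := hx hxab
    refine ⟨inner ℝ Z D, ?_, ?_⟩
    · simpa using (hasDerivAt_const x Z).inner ℝ h1
    · have h3 : inner ℝ Z D = inner ℝ Z v + inner ℝ Z (D - v) := by rw [inner_sub_right]; ring
      have h4 := real_inner_le_norm Z (D - v)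
      have h5 := mul_le_mul_of_nonneg_left (h2.trans (le_abs_self ε)) (norm_nonneg Z)
      linarith)
  have h1 : ‖Z‖ * ‖Z‖ ≤ ‖Z‖ * (|ε| * (b - a)) := by
    rw [← real_inner_self_eq_norm_mul_norm]
    nth_rewrite 2 [hZ]
    rw [inner_sub_right, inner_sub_right, inner_smul_right]
    linarith
  rcases (norm_nonneg Z).eq_or_lt with h0 | h0
  · rw [← h0]; exact mul_nonneg (abs_nonneg _) (by linarith)
  · exact le_of_mul_le_mul_left h1 h0

/-- An absolutely continuous curve whose almost everywhere derivative has a right-continuous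
representative is right-differentiable, with derivative that representative. -/
theorem AbsolutelyContinuousOnInterval.hasDerivWithinAt_Ici {X V : ℝ → E} {t : ℝ}
    (ht : 0 ≤ t) (hX : ∀ T, 0 ≤ T → AbsolutelyContinuousOnInterval X 0 T)
    (hd : ∀ᵐ r : ℝ, 0 < r → HasDerivAt X (V r) r)
    (hV : Tendsto V (𝓝[>] t) (𝓝 (V t))) :
    HasDerivWithinAt X (V t) (Ici t) t := by
  rw [hasDerivWithinAt_iff_isLittleO, Asymptotics.isLittleO_iff]
  intro ε hε
  have h1 := hV (Metric.closedBall_mem_nhds (V t) hε)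
  obtain ⟨u, hu, h2⟩ := mem_nhdsGT_iff_exists_Ioo_subset.1 h1
  filter_upwards [Ico_mem_nhdsGE hu] with x hx
  have h3 : AbsolutelyContinuousOnInterval X t x :=
    (hX x (ht.trans hx.1)).mono (by
      rw [uIcc_of_le hx.1, uIcc_of_le (ht.trans hx.1)]
      exact Icc_subset_Icc_left ht)
  have h4 := h3.norm_sub_sub_smul_le (ε := ε) (v := V t) hx.1 (by
    filter_upwards [hd] with r hr hrx
    refine ⟨V r, hr (ht.trans_lt hrx.1), ?_⟩
    have := h2 ⟨hrx.1, hrx.2.trans hx.2⟩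
    simpa [dist_eq_norm] using this)
  rw [abs_of_pos hε] at h4
  rwa [Real.norm_eq_abs, abs_of_nonneg (sub_nonneg.2 hx.1)]

end AbsolutelyContinuousCurves

namespace EulerAlignment

/-! ### Steps and tail integrals. -/

section StepFunctions

/-- The indicator function of `[x, ∞)`, as an element of `L²(Ω)`. -/
noncomputable def step (x : ℝ) : L2 :=
  indicatorConstLp 2 (measurableSet_Ici (a := x)) (measure_ne_top massMeasure _) (1 : ℝ)

theorem inner_step (Y : L2) (x : ℝ) : inner ℝ Y (step x) = ∫ m in Ici x, Y m ∂massMeasure := by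
  rw [real_inner_comm]
  exact L2.inner_indicatorConstLp_one _ _ Y

theorem step_ae_eq (x : ℝ) : step x =ᵐ[massMeasure] (Ici x).indicator fun _ => (1 : ℝ) :=
  indicatorConstLp_coeFn

theorem ae_massMeasure_mem : ∀ᵐ x ∂massMeasure, x ∈ Ioo (0 : ℝ) 1 :=
  ae_restrict_mem measurableSet_Ioo

theorem step_zero_ae_eq : step 0 =ᵐ[massMeasure] fun _ => (1 : ℝ) := by
  filter_upwards [step_ae_eq 0, ae_massMeasure_mem] with x hx h
  rw [hx, indicator_of_mem (mem_Ici.2 h.1.le)]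

theorem inner_step_zero (Y : L2) : inner ℝ Y (step 0) = ∫ m, Y m ∂massMeasure := by
  rw [L2.inner_def]
  refine integral_congr_ae ?_
  filter_upwards [step_zero_ae_eq] with x hx
  simp [hx]

theorem step_one : step 1 = 0 := by
  rw [Lp.eq_zero_iff_ae_eq_zero]
  filter_upwards [step_ae_eq 1, ae_massMeasure_mem] with x hx h
  rw [hx, indicator_of_notMem (by simpa using h.2)]; rfl

theorem integrable_coeFn (Y : L2) : Integrable Y massMeasure :=
  (Lp.memLp Y).integrable one_le_two

theorem exists_mem_Ioo_of_ae {P : ℝ → Prop} (hP : ∀ᵐ x ∂massMeasure, P x) {a b : ℝ} (hab : a < b)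
    (h : Ioo a b ⊆ Ioo 0 1) : ∃ x ∈ Ioo a b, P x := by
  by_contra! hc
  have h1 : massMeasure (Ioo a b) = 0 :=
    measure_mono_null (fun x hx => hc x hx) (ae_iff.1 hP)
  rw [Measure.restrict_apply measurableSet_Ioo, inter_eq_left.2 h, Real.volume_Ioo] at h1
  simp at h1
  linarith

/-- A square integrable function orthogonal to all steps vanishes. -/
theorem eq_zero_of_inner_step_eq_zero {U : L2}
    (h : ∀ x ∈ Icc (0 : ℝ) 1, inner ℝ U (step x) = 0) : U = 0 := by
  have hU : IntervalIntegrable U volume 0 1 := by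
    rw [intervalIntegrable_iff_integrableOn_Ioo_of_le zero_le_one]
    exact integrable_coeFn U
  have h0 : ∀ x ∈ Icc (0 : ℝ) 1, ∫ m in (0 : ℝ)..x, U m = 0 := by
    intro x hx
    have h1 : ∀ y ∈ Icc (0 : ℝ) 1, ∫ m in y..1, U m = 0 := by
      intro y hy
      rw [← h y hy, inner_step, intervalIntegral.integral_of_le hy.2, integral_Ioc_eq_integral_Ioo,
        Measure.restrict_restrict measurableSet_Ici, ← integral_Icc_eq_integral_Ioo,
        integral_Icc_eq_integral_Ico]
      rcases hy.1.eq_or_lt with rfl | h2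
      · rw [integral_Ico_eq_integral_Ioo]
        congr 2; ext z; simp; intro h3 _; exact h3.le
      · congr 2; ext z; simp; intro h3 _; exact h2.trans_le h3
    have h2 := intervalIntegral.integral_add_adjacent_intervals
      (hU.mono_set (uIcc_subset_uIcc_left (by rwa [uIcc_of_le zero_le_one])) :
        IntervalIntegrable U volume 0 x)
      (hU.mono_set (uIcc_subset_uIcc_right (by rwa [uIcc_of_le zero_le_one])))
    rw [h1 x hx, h1 0 (by simp)] at h2
    simpa using h2
  rw [Lp.eq_zero_iff_ae_eq_zero]
  refine (ae_restrict_iff' measurableSet_Ioo).2 ?_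
  -- Lebesgue differentiation: the primitive of `U` vanishes identically, yet its derivative is `U`
  -- almost everywhere.
  filter_upwards [hU.ae_hasDerivAt_integral] with x hx hx1
  have h1 := hx (by rw [uIcc_of_le zero_le_one]; exact Ioo_subset_Icc_self hx1) 0 (by simp)
  have h2 : HasDerivAt (fun x => ∫ t in (0 : ℝ)..x, U t) 0 x := by
    refine (hasDerivAt_const x (0 : ℝ)).congr_of_eventuallyEq ?_
    filter_upwards [Ioo_mem_nhds hx1.1 hx1.2] with y hy
    exact h0 y (Ioo_subset_Icc_self hy)
  exact h1.unique h2

end StepFunctions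

/-! ### The cone of monotone functions and truncation of values. -/

section Cone

theorem step_mem_cone (x : ℝ) : step x ∈ cone := by
  refine ⟨(Ici x).indicator fun _ => 1, ?_, ?_, step_ae_eq x⟩
  · intro a _ b _ hab
    by_cases h : x ≤ a
    · simp [indicator, h, h.trans hab]
    · simp only [indicator, mem_Ici, h, if_false]; split_ifs <;> simp
  · intro m _
    by_cases h : x ≤ m
    · refine (continuousWithinAt_const (b := (1 : ℝ))).congr (fun y hy => ?_) ?_
      · simp [indicator, h.trans (mem_Ici.1 hy)]
      · simp [indicator, h]
    · refine ContinuousAt.continuousWithinAt ?_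
      refine (continuousAt_const (y := (0 : ℝ))).congr ?_
      filter_upwards [Iio_mem_nhds (not_le.1 h)] with y hy
      simp [indicator, hy.out]

theorem neg_step_zero_mem_cone : -step 0 ∈ cone := by
  refine ⟨fun _ => -1, monotoneOn_const, fun _ _ => continuousWithinAt_const, ?_⟩
  filter_upwards [Lp.coeFn_neg (step 0), step_zero_ae_eq] with x h1 h2
  rw [h1, Pi.neg_apply, h2]

theorem zero_mem_cone : (0 : L2) ∈ cone :=
  ⟨fun _ => 0, monotoneOn_const, fun _ _ => continuousWithinAt_const, Lp.coeFn_zero _ _ _⟩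

theorem add_mem_cone {X Y : L2} (hX : X ∈ cone) (hY : Y ∈ cone) : X + Y ∈ cone := by
  obtain ⟨f, hf, hf', hfX⟩ := hX
  obtain ⟨g, hg, hg', hgY⟩ := hY
  exact ⟨f + g, hf.add hg, fun m hm => (hf' m hm).add (hg' m hm),
    (Lp.coeFn_add X Y).trans (hfX.add hgY)⟩

theorem smul_mem_cone {X : L2} {c : ℝ} (hc : 0 ≤ c) (hX : X ∈ cone) : c • X ∈ cone := by
  obtain ⟨f, hf, hf', hfX⟩ := hX
  refine ⟨fun x => c * f x, fun a ha b hb hab => mul_le_mul_of_nonneg_left (hf ha hb hab) hc,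
    fun m hm => continuousWithinAt_const.mul (hf' m hm), ?_⟩
  filter_upwards [Lp.coeFn_smul c X, hfX] with x h1 h2
  simp [h1, h2]

theorem convex_cone : Convex ℝ cone := fun _ hX _ hY _ _ ha hb _ =>
  add_mem_cone (smul_mem_cone ha hX) (smul_mem_cone hb hY)

/-- Truncation of the values to `[α, β]`, shifted so as to vanish at the origin. -/
def ramp (α β x : ℝ) : ℝ := max α (min β x) - max α (min β 0)

/-- This is what the shift in `ramp` is for: `LipschitzWith.compLp` needs a map fixing `0`. The
shift only adds a constant function, a multiple of `step 0`. -/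
theorem ramp_zero (α β : ℝ) : ramp α β 0 = 0 := sub_self _

theorem monotone_ramp (α β : ℝ) : Monotone (ramp α β) := fun _ _ h =>
  sub_le_sub_right (max_le_max_left _ (min_le_min_left _ h)) _

theorem ramp_sub_le {α β x y : ℝ} (h : x ≤ y) : ramp α β y - ramp α β x ≤ y - x := by
  unfold ramp
  rcases max_cases α (min β y) with h1 | h1 <;> rcases max_cases α (min β x) with h2 | h2 <;>
    rcases min_cases β y with h3 | h3 <;> rcases min_cases β x with h4 | h4 <;> linarith

theorem lipschitzWith_ramp (α β : ℝ) : LipschitzWith 1 (ramp α β) := by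
  refine LipschitzWith.of_le_add fun x y => ?_
  rcases le_total x y with h | h
  · exact (monotone_ramp α β h).trans (le_add_of_nonneg_right dist_nonneg)
  · have := ramp_sub_le (α := α) (β := β) h
    rw [Real.dist_eq, abs_of_nonneg (sub_nonneg.2 h)]
    linarith

/-- The composition of `ramp α β` with an element of `L²(Ω)`. -/
noncomputable def rampLp (α β : ℝ) (X : L2) : L2 :=
  (lipschitzWith_ramp α β).compLp (ramp_zero α β) X

theorem rampLp_ae_eq (α β : ℝ) (X : L2) :
    rampLp α β X =ᵐ[massMeasure] fun m => ramp α β (X m) :=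
  (lipschitzWith_ramp α β).coeFn_compLp (ramp_zero α β) X

theorem continuous_rampLp (α β : ℝ) : Continuous (rampLp α β) :=
  (lipschitzWith_ramp α β).continuous_compLp (ramp_zero α β)

theorem rampLp_mem_cone (α β : ℝ) {X : L2} (hX : X ∈ cone) : rampLp α β X ∈ cone := by
  obtain ⟨f, hf, hf', hfX⟩ := hX
  refine ⟨ramp α β ∘ f, (monotone_ramp α β).comp_monotoneOn hf, fun m hm =>
    (lipschitzWith_ramp α β).continuous.continuousAt.comp_continuousWithinAt (hf' m hm), ?_⟩
  filter_upwards [rampLp_ae_eq α β X, hfX] with x h1 h2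
  simp [h1, h2]

/-- The slopes of `ramp` lie in `[0,1]`, so truncation splits `X` into two nondecreasing summands.
-/
theorem sub_rampLp_mem_cone (α β : ℝ) {X : L2} (hX : X ∈ cone) : X - rampLp α β X ∈ cone := by
  obtain ⟨f, hf, hf', hfX⟩ := hX
  refine ⟨fun x => f x - ramp α β (f x), fun a ha b hb hab => ?_, fun m hm =>
    (hf' m hm).sub ((lipschitzWith_ramp α β).continuous.continuousAt.comp_continuousWithinAt
      (hf' m hm)), ?_⟩
  · have := ramp_sub_le (α := α) (β := β) (hf ha hb hab)
    dsimp only; linarith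
  · filter_upwards [Lp.coeFn_sub X (rampLp α β X), rampLp_ae_eq α β X, hfX] with x h0 h1 h2
    rw [h0, Pi.sub_apply, h1, h2]

end Cone

/-! ### The set `Ω_X` and the closed subspace `ℋ_X`. -/

section StickySpace

theorem isOpen_concentrated (X : L2) : IsOpen (concentrated X) := by
  rw [isOpen_iff_mem_nhds]
  rintro m ⟨hm, c, N, hN, hc⟩
  filter_upwards [Ioo_mem_nhds hm.1 hm.2, eventually_mem_nhds_iff.2 hN] with y hy hy'
  exact ⟨hy, c, N, hy', hc⟩

theorem concentrated_subset (X : L2) : concentrated X ⊆ Ioo 0 1 := fun _ h => h.1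

/-- Every value of `f` near `m` is squeezed between values at points on either side where `f = c`;
such points exist because `f = c` almost everywhere there. -/
theorem exists_nhds_eq_of_mem_concentrated {X : L2} {f : ℝ → ℝ} (hf : MonotoneOn f (Ioo 0 1))
    (hfX : X =ᵐ[massMeasure] f) {m : ℝ} (hm : m ∈ concentrated X) :
    ∃ c : ℝ, ∀ᶠ x in 𝓝 m, f x = c := by
  obtain ⟨hm, c, N, hN, hc⟩ := hm
  refine ⟨c, ?_⟩
  obtain ⟨a, b, hab, h1⟩ := mem_nhds_iff_exists_Ioo_subset.1
    (inter_mem hN (Ioo_mem_nhds hm.1 hm.2))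
  have hc' : ∀ᵐ x ∂massMeasure, x ∈ N → f x = c := by
    filter_upwards [hc, hfX] with x h2 h3 h4
    rw [← h3, h2 h4]
  filter_upwards [Ioo_mem_nhds hab.1 hab.2] with x hx
  have hl : Ioo a x ⊆ Ioo a b := Ioo_subset_Ioo_right hx.2.le
  have hr : Ioo x b ⊆ Ioo a b := Ioo_subset_Ioo_left hx.1.le
  obtain ⟨y, hy, hy'⟩ := exists_mem_Ioo_of_ae hc' hx.1 fun z hz => (h1 (hl hz)).2
  obtain ⟨z, hz, hz'⟩ := exists_mem_Ioo_of_ae hc' hx.2 fun z hz => (h1 (hr hz)).2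
  have e1 := hf (h1 (hl hy)).2 (h1 hx).2 hy.2.le
  have e2 := hf (h1 hx).2 (h1 (hr hz)).2 hz.1.le
  rw [hy' (h1 (hl hy)).1] at e1
  rw [hz' (h1 (hr hz)).1] at e2
  exact le_antisymm e2 e1

/-- On an interval contained in `Ω_X`, a nondecreasing `X` is constant. -/
theorem exists_const_of_mem_cone {X : L2} (hX : X ∈ cone) {a b : ℝ} (hab : a < b)
    (h : Ioo a b ⊆ concentrated X) : ∃ c : ℝ, ∀ᵐ x ∂massMeasure, x ∈ Ioo a b → X x = c := by
  obtain ⟨f, hf, -, hfX⟩ := hX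
  have hd : ∀ x ∈ Ioo a b, HasDerivAt f 0 x := fun x hx => by
    obtain ⟨c, hc⟩ := exists_nhds_eq_of_mem_concentrated hf hfX (h hx)
    exact (hasDerivAt_const x c).congr_of_eventuallyEq hc
  refine ⟨f ((a + b) / 2), ?_⟩
  filter_upwards [hfX] with x hx hx'
  rw [hx]
  exact isOpen_Ioo.is_const_of_deriv_eq_zero (convex_Ioo a b).isPreconnected
    (fun y hy => (hd y hy).differentiableAt.differentiableWithinAt) (fun y hy => (hd y hy).deriv)
    hx' ⟨by linarith, by linarith⟩

theorem mem_concentrated_of_eqOn {X : L2} {f : ℝ → ℝ} (hfX : X =ᵐ[massMeasure] f) {a b c m : ℝ}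
    (hm : m ∈ Ioo a b) (hm1 : m ∈ Ioo (0 : ℝ) 1) (h : ∀ x ∈ Ioo a b, f x = c) :
    m ∈ concentrated X := by
  refine ⟨hm1, c, Ioo a b, Ioo_mem_nhds hm.1 hm.2, ?_⟩
  filter_upwards [hfX] with x hx hx'
  rw [hx, h x hx']

/-- The space `ℋ_X`, as a linear subspace. -/
def stickySubmodule (X : L2) : Submodule ℝ L2 where
  carrier := stickySpace X
  zero_mem' := fun a b _ _ => ⟨0, by filter_upwards [Lp.coeFn_zero ℝ 2 massMeasure] with x hx _
                                     simpa using hx⟩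
  add_mem' := by
    intro U V hU hV a b hab h
    obtain ⟨c, hc⟩ := hU a b hab h
    obtain ⟨d, hd⟩ := hV a b hab h
    refine ⟨c + d, ?_⟩
    filter_upwards [hc, hd, Lp.coeFn_add U V] with x h1 h2 h3 h4
    rw [h3, Pi.add_apply, h1 h4, h2 h4]
  smul_mem' := by
    intro r U hU a b hab h
    obtain ⟨c, hc⟩ := hU a b hab h
    refine ⟨r * c, ?_⟩
    filter_upwards [hc, Lp.coeFn_smul r U] with x h1 h3 h4
    simp [h3, h1 h4]

theorem isClosed_stickySpace (X : L2) : IsClosed (stickySpace X) := by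
  refine IsSeqClosed.isClosed ?_
  intro U u hU hu a b hab h
  obtain ⟨ns, -, hns⟩ := (tendstoInMeasure_of_tendsto_Lp hu).exists_seq_tendsto_ae
  choose c hc using fun n => hU (ns n) a b hab h
  have hall : ∀ᵐ x ∂massMeasure, x ∈ Ioo a b → Tendsto c atTop (𝓝 (u x)) := by
    filter_upwards [hns, ae_all_iff.2 hc] with x h1 h2 h3
    exact h1.congr fun n => h2 n h3
  -- One sample point suffices to see that the constants `c n` converge.
  obtain ⟨y, hy, hy'⟩ := exists_mem_Ioo_of_ae hall hab (h.trans (concentrated_subset X))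
  refine ⟨u y, ?_⟩
  filter_upwards [hall] with x hx hx'
  exact tendsto_nhds_unique (hx hx') (hy' hy)

instance (X : L2) : CompleteSpace (stickySubmodule X) :=
  (isClosed_stickySpace X).completeSpace_coe

theorem stickySubmodule_anti {X Y : L2} (h : concentrated X ⊆ concentrated Y) :
    stickySubmodule Y ≤ stickySubmodule X := fun _ hU a b hab hI => hU a b hab (hI.trans h)

theorem mem_stickySpace_self {X : L2} (hX : X ∈ cone) : X ∈ stickySpace X :=
  fun _ _ hab h => exists_const_of_mem_cone hX hab h

theorem rampLp_mem_stickySpace (α β : ℝ) {X : L2} (hX : X ∈ cone) :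
    rampLp α β X ∈ stickySpace X := by
  intro a b hab h
  obtain ⟨c, hc⟩ := exists_const_of_mem_cone hX hab h
  refine ⟨ramp α β c, ?_⟩
  filter_upwards [hc, rampLp_ae_eq α β X] with x h1 h2 h3
  rw [h2, h1 h3]

theorem conv_mem_stickySpace (p : Protocol) {X : L2} (hX : X ∈ cone) :
    p.conv X ∈ stickySpace X := by
  intro a b hab h
  obtain ⟨c, hc⟩ := exists_const_of_mem_cone hX hab h
  refine ⟨∫ ω, p.Phi (c - X ω) ∂massMeasure, ?_⟩
  filter_upwards [hc, (p.memLp_conv X).coeFn_toLp] with x h1 h2 h3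
  rw [Protocol.conv, h2, h1 h3]

/-- An interval inside `Ω_X` misses `e`, hence lies on one side of the jump. -/
theorem step_mem_stickySpace {X : L2} {e : ℝ} (he : e ∉ concentrated X) :
    step e ∈ stickySpace X := by
  intro a b hab h
  rcases le_or_gt e a with h1 | h1
  · refine ⟨1, ?_⟩
    filter_upwards [step_ae_eq e] with x hx hx'
    rw [hx, indicator_of_mem (mem_Ici.2 (h1.trans hx'.1.le))]
  · have h2 : b ≤ e := le_of_not_gt fun h2 => he (h ⟨h1, h2⟩)
    refine ⟨0, ?_⟩
    filter_upwards [step_ae_eq e] with x hx hx'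
    rw [hx, indicator_of_notMem (by simpa using hx'.2.trans_le h2)]

end StickySpace

/-! ### Tail integrals, truncations and `ℋ_X`. -/

section Geometry

theorem ae_massMeasure_ne (e : ℝ) : ∀ᵐ m ∂massMeasure, m ≠ e :=
  compl_mem_ae_iff.2 (measure_singleton e)

theorem lt_of_notMem_concentrated {X : L2} {f : ℝ → ℝ} (hf : MonotoneOn f (Ioo 0 1))
    (hfX : X =ᵐ[massMeasure] f) {a b e : ℝ} (he : e ∈ Ioo a b) (ha : a ∈ Ioo (0 : ℝ) 1)
    (hb : b ∈ Ioo (0 : ℝ) 1) (hX : e ∉ concentrated X) : f a < f b := by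
  have hs : ∀ x ∈ Ioo a b, x ∈ Ioo (0 : ℝ) 1 := fun x hx =>
    ⟨ha.1.trans hx.1, hx.2.trans hb.2⟩
  refine lt_of_not_ge fun h => hX (mem_concentrated_of_eqOn (c := f a) hfX he (hs e he) fun x hx => ?_)
  exact le_antisymm ((hf (hs x hx) hb hx.2.le).trans h) (hf ha (hs x hx) hx.1.le)

/-- A function orthogonal to all truncations of `X` has vanishing tail integrals from every point
outside of `Ω_X`. -/
theorem inner_step_eq_zero_of_inner_rampLp {X Y : L2} (hX : X ∈ cone)
    (h0 : inner ℝ Y (step 0) = 0) (hr : ∀ α β, α < β → inner ℝ Y (rampLp α β X) = 0)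
    {e : ℝ} (he : e ∈ Ioo (0 : ℝ) 1) (heX : e ∉ concentrated X) : inner ℝ Y (step e) = 0 := by
  obtain ⟨f, hf, -, hfX⟩ := hX
  rw [inner_step_zero] at h0
  have hYi := integrable_coeFn Y
  obtain ⟨u, -, hu, hul⟩ := exists_seq_strictAnti_tendsto' (show (0 : ℝ) < min e (1 - e) from
    lt_min he.1 (sub_pos.2 he.2))
  have hum : ∀ n, e - u n ∈ Ioo (0 : ℝ) 1 ∧ e + u n ∈ Ioo (0 : ℝ) 1 := fun n => by
    have h1 := (hu n).1
    have h2 := lt_min_iff.1 (hu n).2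
    have := he.1
    have := he.2
    constructor <;> constructor <;> linarith
  have hue : ∀ n, e ∈ Ioo (e - u n) (e + u n) := fun n => by
    have h1 := (hu n).1
    constructor <;> linarith
  have hlt : ∀ n, f (e - u n) < f (e + u n) := fun n =>
    lt_of_notMem_concentrated hf hfX (hue n) (hum n).1 (hum n).2 heX
  -- The truncation of `X` to the values between `f (e - u n)` and `f (e + u n)`, rescaled to run
  -- from `0` to `1`. The window is nondegenerate because `e ∉ Ω_X`, and `g n` tends a.e. to the
  -- indicator of `[e, ∞)`.
  set g : ℕ → ℝ → ℝ := fun n m =>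
    (max (f (e - u n)) (min (f (e + u n)) (X m)) - f (e - u n)) / (f (e + u n) - f (e - u n))
    with hg
  have hg01 : ∀ n m, 0 ≤ g n m ∧ g n m ≤ 1 := fun n m => by
    have h1 : 0 < f (e + u n) - f (e - u n) := sub_pos.2 (hlt n)
    refine ⟨div_nonneg (sub_nonneg.2 (le_max_left _ _)) h1.le, (div_le_one h1).2 ?_⟩
    exact sub_le_sub_right (max_le (hlt n).le (min_le_left _ _)) _
  have hgm : ∀ n, AEStronglyMeasurable (g n) massMeasure := fun n => by
    have hc : Continuous fun x : ℝ =>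
      (max (f (e - u n)) (min (f (e + u n)) x) - f (e - u n)) / (f (e + u n) - f (e - u n)) := by
      fun_prop
    exact hc.comp_aestronglyMeasurable (Lp.aestronglyMeasurable X)
  have hint : ∀ n, ∫ m, Y m * g n m ∂massMeasure = 0 := fun n => by
    have h1 := hr _ _ (hlt n)
    rw [L2.inner_def] at h1
    have h1' : ∫ m, Y m * ramp (f (e - u n)) (f (e + u n)) (X m) ∂massMeasure = 0 := by
      rw [← h1]
      refine integral_congr_ae ?_
      filter_upwards [rampLp_ae_eq (f (e - u n)) (f (e + u n)) X] with x hx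
      simp [hx, mul_comm]
    set D := f (e + u n) - f (e - u n)
    set k := max (f (e - u n)) (min (f (e + u n)) 0) - f (e - u n)
    -- `g n` is affine in the ramp; the constant part integrates to zero against `Y` by `h0`.
    have h2 : ∀ m, Y m * g n m =
        D⁻¹ * (Y m * ramp (f (e - u n)) (f (e + u n)) (X m)) + (D⁻¹ * k) * Y m := fun m => by
      simp only [hg, ramp, k, D]; ring
    have hi : Integrable (fun m => Y m * ramp (f (e - u n)) (f (e + u n)) (X m)) massMeasure := by
      refine (L2.integrable_inner (𝕜 := ℝ) Y (rampLp (f (e - u n)) (f (e + u n)) X)).congr ?_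
      filter_upwards [rampLp_ae_eq (f (e - u n)) (f (e + u n)) X] with x hx
      simp [hx, mul_comm]
    simp_rw [h2]
    rw [integral_add (hi.const_mul _) (hYi.const_mul _), integral_const_mul, integral_const_mul,
      h1', h0]
    simp
  have hlim : Tendsto (fun n => ∫ m, Y m * g n m ∂massMeasure) atTop
      (𝓝 (∫ m, Y m * (Ici e).indicator (fun _ => 1) m ∂massMeasure)) := by
    refine tendsto_integral_of_dominated_convergence (fun m => ‖Y m‖)
      (fun n => (Lp.aestronglyMeasurable Y).mul (hgm n)) hYi.norm (fun n => ?_) ?_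
    · refine Eventually.of_forall fun m => ?_
      rw [norm_mul, Real.norm_eq_abs (g n m), abs_of_nonneg (hg01 n m).1]
      exact mul_le_of_le_one_right (norm_nonneg _) (hg01 n m).2
    · filter_upwards [ae_massMeasure_ne e, hfX, ae_massMeasure_mem] with m hme hm hm1
      refine Tendsto.const_mul _ ?_
      rcases hme.lt_or_gt with h | h
      · rw [indicator_of_notMem (by simpa using h)]
        refine tendsto_const_nhds.congr' ?_
        filter_upwards [hul.eventually (Iio_mem_nhds (sub_pos.2 h))] with n hn
        have h1 : X m ≤ f (e - u n) := by
          rw [hm]; exact hf hm1 (hum n).1 (by have : u n < e - m := hn; linarith)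
        simp only [hg]
        rw [max_eq_left ((min_le_right _ _).trans h1)]; simp
      · rw [indicator_of_mem (mem_Ici.2 h.le)]
        refine tendsto_const_nhds.congr' ?_
        filter_upwards [hul.eventually (Iio_mem_nhds (sub_pos.2 h))] with n hn
        have h1 : f (e + u n) ≤ X m := by
          rw [hm]; exact hf (hum n).2 hm1 (by have : u n < m - e := hn; linarith)
        simp only [hg]
        rw [min_eq_left h1, max_eq_right (hlt n).le, div_self (sub_pos.2 (hlt n)).ne']
  simp only [hint] at hlim
  have h3 := tendsto_nhds_unique hlim tendsto_const_nhds
  rw [inner_step, ← h3, ← integral_indicator measurableSet_Ici]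
  refine integral_congr_ae (Eventually.of_forall fun m => ?_)
  by_cases hm : m ∈ Ici e <;> simp [hm]

/-- For an element of `ℋ_X`, the sign of the tail integrals is determined outside of `Ω_X`. -/
theorem inner_step_nonpos_of_mem_stickySpace {X U : L2} (hU : U ∈ stickySpace X)
    (h0 : inner ℝ U (step 0) = 0)
    (h : ∀ e ∈ Ioo (0 : ℝ) 1, e ∉ concentrated X → inner ℝ U (step e) ≤ 0)
    {x : ℝ} (hx : x ∈ Icc (0 : ℝ) 1) : inner ℝ U (step x) ≤ 0 := by
  -- The endpoints `0` and `1` belong to `C`, and the tail integral vanishes at both.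
  set C := Icc (0 : ℝ) 1 \ concentrated X with hC
  have hCc : IsClosed C := isClosed_Icc.sdiff (isOpen_concentrated X)
  have h0C : (0 : ℝ) ∈ C := ⟨by simp, fun h => lt_irrefl _ h.1.1⟩
  have h1C : (1 : ℝ) ∈ C := ⟨by simp, fun h => lt_irrefl _ h.1.2⟩
  have hneg : ∀ e ∈ C, inner ℝ U (step e) ≤ 0 := by
    intro e he
    rcases he.1.1.eq_or_lt with rfl | h2
    · exact h0.le
    rcases he.1.2.eq_or_lt with rfl | h3
    · simp [step_one]
    exact h e ⟨h2, h3⟩ he.2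
  by_cases hxC : x ∈ C
  · exact hneg x hxC
  have hA : IsClosed (C ∩ Iic x) := hCc.inter isClosed_Iic
  have hB : IsClosed (C ∩ Ici x) := hCc.inter isClosed_Ici
  have hAb : BddAbove (C ∩ Iic x) := ⟨x, fun y hy => hy.2⟩
  have hBb : BddBelow (C ∩ Ici x) := ⟨x, fun y hy => hy.2⟩
  have ha := hA.csSup_mem ⟨0, h0C, hx.1⟩ hAb
  have hb := hB.csInf_mem ⟨1, h1C, hx.2⟩ hBb
  -- `(a, b)` is the component of `Ω_X` containing `x`.
  set a := sSup (C ∩ Iic x)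
  set b := sInf (C ∩ Ici x)
  have hax : a < x := lt_of_le_of_ne ha.2 fun h => hxC (h ▸ ha.1)
  have hxb : x < b := lt_of_le_of_ne hb.2 fun h => hxC (h ▸ hb.1)
  have hsub : Ioo a b ⊆ concentrated X := by
    intro y hy
    by_contra hyX
    have hyC : y ∈ C := ⟨⟨ha.1.1.1.trans hy.1.le, hy.2.le.trans hb.1.1.2⟩, hyX⟩
    rcases le_total y x with h | h
    · exact absurd (le_csSup hAb ⟨hyC, h⟩) (not_le.2 hy.1)
    · exact absurd (csInf_le hBb ⟨hyC, h⟩) (not_le.2 hy.2)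
  obtain ⟨c, hc⟩ := hU a b (hax.trans hxb) hsub
  -- `U` is constant on `(a, b)`, so its tail integral is affine on `[a, b]` and bounded by its
  -- larger endpoint value.
  have key : ∀ y, a ≤ y → y ≤ b → inner ℝ U (step y) = inner ℝ U (step b) + c * (b - y) := by
    intro y hay hyb
    have hd : Disjoint (Ico y b) (Ici b) := by
      rw [Set.disjoint_left]; intro z hz hz'; exact absurd hz.2 (not_lt.2 hz')
    rw [inner_step, inner_step, ← Ico_union_Ici_eq_Ici hyb,
      setIntegral_union hd measurableSet_Ici (integrable_coeFn U).integrableOn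
        (integrable_coeFn U).integrableOn, add_comm]
    congr 1
    have h1 : ∫ m in Ico y b, U m ∂massMeasure = ∫ _m in Ico y b, c ∂massMeasure := by
      refine setIntegral_congr_ae measurableSet_Ico ?_
      filter_upwards [hc, ae_massMeasure_ne a] with m hm hma hm'
      exact hm ⟨lt_of_le_of_ne (hay.trans hm'.1) hma.symm, hm'.2⟩
    have hset : massMeasure.real (Ico y b) = b - y := by
      rw [measureReal_def, measure_congr Ioo_ae_eq_Ico.symm,
        Measure.restrict_apply measurableSet_Ioo, inter_eq_left.2, Real.volume_Ioo,
        ENNReal.toReal_ofReal (by linarith)]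
      exact Ioo_subset_Ioo (ha.1.1.1.trans hay) hb.1.1.2
    rw [h1, setIntegral_const, hset, smul_eq_mul, mul_comm]
  have e1 := key a le_rfl (hax.trans hxb).le
  have e2 := key x hax.le hxb.le
  have n1 := hneg a ha.1
  have n2 := hneg b hb.1
  rcases le_total c 0 with h | h
  · rw [e2]; nlinarith
  · rw [e1] at n1; rw [e2]; nlinarith

theorem starProjection_inner_step_zero (X Y : L2) :
    inner ℝ ((stickySubmodule X).starProjection Y) (step 0) = inner ℝ Y (step 0) := by
  rw [Submodule.inner_starProjection_left_eq_right, Submodule.starProjection_eq_self_iff.2]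
  exact step_mem_stickySpace fun h => lt_irrefl _ h.1.1

theorem starProjection_inner_step {X : L2} (Y : L2) {e : ℝ} (he : e ∉ concentrated X) :
    inner ℝ ((stickySubmodule X).starProjection Y) (step e) = inner ℝ Y (step e) := by
  rw [Submodule.inner_starProjection_left_eq_right, Submodule.starProjection_eq_self_iff.2]
  exact step_mem_stickySpace he

/-- The truncations of `X` and the constants span a dense subspace of `ℋ_X`. -/
theorem inner_eq_zero_of_mem_stickySpace {X Y U : L2} (hX : X ∈ cone)
    (h0 : inner ℝ Y (step 0) = 0) (hr : ∀ α β, α < β → inner ℝ Y (rampLp α β X) = 0)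
    (hU : U ∈ stickySpace X) : inner ℝ Y U = 0 := by
  set P := (stickySubmodule X).starProjection Y with hP
  have hPmem : P ∈ stickySubmodule X := Submodule.starProjection_apply_mem _ _
  have hP0 : inner ℝ P (step 0) = 0 := by rw [hP, starProjection_inner_step_zero, h0]
  have hPe : ∀ e ∈ Ioo (0 : ℝ) 1, e ∉ concentrated X → inner ℝ P (step e) = 0 := fun e he heX => by
    rw [hP, starProjection_inner_step Y heX, inner_step_eq_zero_of_inner_rampLp hX h0 hr he heX]
  -- The projection `P` keeps the tail integrals of `Y` outside `Ω_X` and lies in `ℋ_X`, so the sign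
  -- lemma applies to both `P` and `-P`.
  have hPz : P = 0 := eq_zero_of_inner_step_eq_zero fun x hx => by
    refine le_antisymm (inner_step_nonpos_of_mem_stickySpace hPmem hP0
      (fun e he heX => (hPe e he heX).le) hx) ?_
    have := inner_step_nonpos_of_mem_stickySpace (U := -P) ((stickySubmodule X).neg_mem hPmem)
      (by rw [inner_neg_left, hP0, neg_zero])
      (fun e he heX => by rw [inner_neg_left, hPe e he heX, neg_zero]) hx
    rw [inner_neg_left] at this
    linarith
  have h1 : (stickySubmodule X).starProjection U = U :=
    Submodule.starProjection_eq_self_iff.2 hU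
  rw [← h1, ← Submodule.inner_starProjection_left_eq_right, ← hP, hPz, inner_zero_left]

/-- Used for superlevel sets of monotone functions. The half-line starts at the infimum, or at `1`
when `S` is empty. -/
theorem exists_Ici_ae_eq_of_isUpper {S : Set ℝ} (hS : S ⊆ Ioo 0 1)
    (hup : ∀ x ∈ S, ∀ y ∈ Ioo (0 : ℝ) 1, x ≤ y → y ∈ S) :
    ∃ x ∈ Icc (0 : ℝ) 1, S =ᵐ[massMeasure] Ici x := by
  rcases S.eq_empty_or_nonempty with rfl | hne
  · refine ⟨1, by simp, ?_⟩
    filter_upwards [ae_massMeasure_mem] with m hm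
    refine propext ⟨fun h => h.elim, fun h => absurd hm.2 (not_lt.2 h)⟩
  · have hb : BddBelow S := ⟨0, fun y hy => (hS hy).1.le⟩
    obtain ⟨s, hs⟩ := hne
    refine ⟨sInf S, ⟨le_csInf ⟨s, hs⟩ fun y hy => (hS hy).1.le,
      (csInf_le hb hs).trans (hS hs).2.le⟩, ?_⟩
    filter_upwards [ae_massMeasure_mem, ae_massMeasure_ne (sInf S)] with m hm hmi
    refine propext ⟨fun h => csInf_le hb h, fun h => ?_⟩
    obtain ⟨y, hy, hym⟩ := exists_lt_of_csInf_lt ⟨s, hs⟩ (lt_of_le_of_ne h hmi.symm)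
    exact hup y hy m hm hym.le

end Geometry

/-! ### Polar cone and normal cones of `𝒦`. -/

section NormalCone

/-- Nonpositivity of the tail integrals tests membership in the polar cone of `𝒦`. -/
theorem inner_nonpos_of_inner_step_nonpos {Y Z : L2} (h0 : inner ℝ Y (step 0) = 0)
    (h : ∀ x ∈ Icc (0 : ℝ) 1, inner ℝ Y (step x) ≤ 0) (hZ : Z ∈ cone) : inner ℝ Y Z ≤ 0 := by
  obtain ⟨f, hf, -, hfZ⟩ := hZ
  rw [inner_step_zero] at h0
  have hYi := integrable_coeFn Y
  have hZm : Measurable Z := (Lp.stronglyMeasurable Z).measurable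
  -- Layer-cake argument: each superlevel set of `Z` is a.e. a half-line, so its indicator is a
  -- step.
  have hlayer : ∀ α : ℝ, ∫ m, Y m * (Iio (Z m)).indicator (fun _ => (1 : ℝ)) α ∂massMeasure ≤ 0 := by
    intro α
    obtain ⟨x, hx, hxS⟩ := exists_Ici_ae_eq_of_isUpper (S := {m | m ∈ Ioo (0 : ℝ) 1 ∧ α < f m})
      (fun m hm => hm.1) fun y hy z hz hyz => ⟨hz, hy.2.trans_le (hf hy.1 hz hyz)⟩
    refine le_of_eq_of_le ?_ (h x hx)
    rw [inner_step, ← integral_indicator measurableSet_Ici]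
    refine integral_congr_ae ?_
    filter_upwards [hxS.mem_iff, hfZ, ae_massMeasure_mem] with m h1 h2 h3
    by_cases h4 : m ∈ Ici x
    · have h5 : α < Z m := by rw [h2]; exact (h1.2 h4).2
      simp [mem_Ici.1 h4, h5]
    · have h5 : ¬ α < Z m := fun h5 => h4 (h1.1 ⟨h3, by rwa [← h2]⟩)
      rw [indicator_of_notMem h4, indicator_of_notMem (by simpa using h5), mul_zero]
  -- Integrating the layers over `α ∈ (-N, N)` gives the truncation of `Z` plus the constant `N`,
  -- which `h0` removes.
  have hN : ∀ N : ℕ, ∫ m, Y m * max (-N : ℝ) (min N (Z m)) ∂massMeasure ≤ 0 := by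
    intro N
    have hcl : ∀ z : ℝ, ∫ α in Ioo (-N : ℝ) N, (Iio z).indicator (fun _ => (1 : ℝ)) α =
        max (-N : ℝ) (min N z) + N := fun z => by
      rw [setIntegral_indicator measurableSet_Iio, Ioo_inter_Iio, setIntegral_const,
        Real.volume_real_Ioo]
      have hN0 : (0 : ℝ) ≤ N := N.cast_nonneg
      rcases max_cases (min (N : ℝ) z - -N) 0 with h1 | h1 <;>
        rcases max_cases (-N : ℝ) (min N z) with h2 | h2 <;> simp only [smul_eq_mul] <;> linarith
    have hjoint : Integrable (fun q : ℝ × ℝ => Y q.1 * (Iio (Z q.1)).indicator (fun _ => (1 : ℝ)) q.2)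
        (massMeasure.prod (volume.restrict (Ioo (-N : ℝ) N))) := by
      have hb : Integrable (fun q : ℝ × ℝ => Y q.1)
          (massMeasure.prod (volume.restrict (Ioo (-N : ℝ) N))) := hYi.comp_fst _
      refine hb.mono (hb.1.mul ?_) (Eventually.of_forall fun q => ?_)
      · have hS : MeasurableSet {q : ℝ × ℝ | q.2 < Z q.1} :=
          measurableSet_lt measurable_snd (hZm.comp measurable_fst)
        exact ((measurable_const (a := (1 : ℝ))).indicator hS).aestronglyMeasurable
      · rw [norm_mul]
        refine mul_le_of_le_one_right (norm_nonneg _) ?_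
        by_cases h1 : q.2 < Z q.1 <;> simp [h1]
    have hswap := integral_integral_swap
      (f := fun m α => Y m * (Iio (Z m)).indicator (fun _ => (1 : ℝ)) α) hjoint
    have hle : ∫ m, (∫ α in Ioo (-N : ℝ) N, Y m * (Iio (Z m)).indicator (fun _ => (1 : ℝ)) α)
        ∂massMeasure ≤ 0 := by
      rw [hswap]
      exact integral_nonpos fun α => hlayer α
    simp_rw [integral_const_mul, hcl] at hle
    have hi : Integrable (fun m => Y m * max (-N : ℝ) (min N (Z m))) massMeasure := by
      refine (hYi.norm.const_mul (N : ℝ)).mono' (hYi.1.mul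
        (by fun_prop : Measurable fun m => max (-N : ℝ) (min N (Z m))).aestronglyMeasurable)
        (Eventually.of_forall fun m => ?_)
      rw [norm_mul, mul_comm]
      refine mul_le_mul_of_nonneg_right ?_ (norm_nonneg _)
      rw [Real.norm_eq_abs, abs_le]
      exact ⟨le_max_left _ _, max_le (by linarith [(N.cast_nonneg : (0 : ℝ) ≤ N)]) (min_le_left _ _)⟩
    simp_rw [mul_add] at hle
    rwa [integral_add hi (hYi.mul_const _), integral_mul_const, h0, zero_mul, add_zero] at hle
  have hlim : Tendsto (fun N : ℕ => ∫ m, Y m * max (-N : ℝ) (min N (Z m)) ∂massMeasure) atTop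
      (𝓝 (∫ m, Y m * Z m ∂massMeasure)) := by
    have hYZ : Integrable (fun m => Y m * Z m) massMeasure :=
      (Lp.memLp Y).integrable_mul (Lp.memLp Z)
    refine tendsto_integral_of_dominated_convergence (fun m => ‖Y m * Z m‖)
      (fun N => hYi.1.mul
        (by fun_prop : Measurable fun m => max (-N : ℝ) (min N (Z m))).aestronglyMeasurable)
      hYZ.norm (fun N => Eventually.of_forall fun m => ?_) (Eventually.of_forall fun m => ?_)
    · rw [norm_mul, norm_mul]
      refine mul_le_mul_of_nonneg_left ?_ (norm_nonneg _)
      have hN0 : (0 : ℝ) ≤ N := N.cast_nonneg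
      rw [Real.norm_eq_abs, Real.norm_eq_abs, abs_le]
      have h1 := neg_abs_le (Z m)
      have h2 := le_abs_self (Z m)
      have h3 := abs_nonneg (Z m)
      constructor
      · rcases max_cases (-N : ℝ) (min N (Z m)) with h4 | h4 <;>
          rcases min_cases (N : ℝ) (Z m) with h5 | h5 <;> linarith
      · exact max_le (by linarith) ((min_le_right _ _).trans h2)
    · refine Tendsto.const_mul _ (tendsto_const_nhds.congr' ?_)
      filter_upwards [eventually_ge_atTop ⌈|Z m|⌉₊] with N hN
      have h1 : |Z m| ≤ N := (Nat.le_ceil _).trans (Nat.cast_le.2 hN)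
      rw [min_eq_right ((le_abs_self _).trans h1), max_eq_right (abs_le.1 h1).1]
  have := le_of_tendsto' hlim hN
  rw [L2.inner_def]
  simpa [mul_comm] using this

/-- Since `𝒦` is a cone, `X + Z` is an admissible test point; testing with `0` as well gives
orthogonality to `X` in the next lemma. -/
theorem inner_nonpos_of_normal {X Y Z : L2} (hX : X ∈ cone)
    (hY : ∀ Z ∈ cone, inner ℝ Y (Z - X) ≤ 0) (hZ : Z ∈ cone) : inner ℝ Y Z ≤ 0 := by
  simpa using hY (X + Z) (add_mem_cone hX hZ)

theorem inner_self_eq_zero_of_normal {X Y : L2} (hX : X ∈ cone)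
    (hY : ∀ Z ∈ cone, inner ℝ Y (Z - X) ≤ 0) : inner ℝ Y X = 0 := by
  refine le_antisymm (inner_nonpos_of_normal hX hY hX) ?_
  simpa [inner_neg_right] using hY 0 zero_mem_cone

theorem inner_step_zero_eq_zero_of_polar {Y : L2} (hY : ∀ Z ∈ cone, inner ℝ Y Z ≤ 0) :
    inner ℝ Y (step 0) = 0 := by
  refine le_antisymm (hY _ (step_mem_cone 0)) ?_
  have := hY _ neg_step_zero_mem_cone
  rw [inner_neg_right] at this
  linarith

/-- The normal cone to `𝒦` at `X` is orthogonal to `ℋ_X`. -/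
theorem inner_eq_zero_of_normal {X Y U : L2} (hX : X ∈ cone)
    (hY : ∀ Z ∈ cone, inner ℝ Y (Z - X) ≤ 0) (hU : U ∈ stickySpace X) : inner ℝ Y U = 0 := by
  refine inner_eq_zero_of_mem_stickySpace hX
    (inner_step_zero_eq_zero_of_polar fun Z hZ => inner_nonpos_of_normal hX hY hZ)
    (fun α β _ => ?_) hU
  -- `Y` pairs nonpositively with both summands of `X`, and their sum pairs to zero, so each pairing
  -- vanishes.
  have h1 := inner_nonpos_of_normal hX hY (rampLp_mem_cone α β hX)
  have h2 := inner_nonpos_of_normal hX hY (sub_rampLp_mem_cone α β hX)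
  rw [inner_sub_right, inner_self_eq_zero_of_normal hX hY] at h2
  linarith

/-- The projection onto `ℋ_X` preserves the polar cone of `𝒦`. -/
theorem inner_starProjection_nonpos_of_polar {X Y Z : L2}
    (hY : ∀ Z ∈ cone, inner ℝ Y Z ≤ 0) (hZ : Z ∈ cone) :
    inner ℝ ((stickySubmodule X).starProjection Y) Z ≤ 0 := by
  have h0 : inner ℝ ((stickySubmodule X).starProjection Y) (step 0) = 0 := by
    rw [starProjection_inner_step_zero, inner_step_zero_eq_zero_of_polar hY]
  refine inner_nonpos_of_inner_step_nonpos h0 (fun x hx => ?_) hZ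
  have hP : (stickySubmodule X).starProjection Y ∈ stickySubmodule X :=
    Submodule.starProjection_apply_mem _ _
  -- Outside `Ω_X` the steps lie in `ℋ_X`, so projecting leaves those tail integrals unchanged.
  refine inner_step_nonpos_of_mem_stickySpace hP h0
    (fun e _ heX => ?_) hx
  rw [starProjection_inner_step Y heX]
  exact hY _ (step_mem_cone e)

theorem mem_subdifferential_coneIndicator {X Y : L2} (hX : X ∈ cone)
    (hY : ∀ Z ∈ cone, inner ℝ Y (Z - X) ≤ 0) : Y ∈ subdifferential coneIndicator X := by
  intro Z
  by_cases hZ : Z ∈ cone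
  · simp only [coneIndicator, hX, hZ, if_true, zero_add]
    exact_mod_cast hY Z hZ
  · simp [coneIndicator, hZ]

theorem isProj_cone {X W : L2} (hX : X ∈ cone)
    (h : ∀ Z ∈ cone, inner ℝ (W - X) (Z - X) ≤ 0) : IsProj cone W X := by
  refine ⟨hX, fun Z hZ hne => ?_⟩
  refine lt_of_pow_lt_pow_left₀ 2 (norm_nonneg _) ?_
  have h1 : W - Z = (W - X) - (Z - X) := by abel
  have h2 : 0 < ‖Z - X‖ := norm_pos_iff.2 (sub_ne_zero.2 hne)
  rw [h1, norm_sub_sq_real (W - X)]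
  nlinarith [h Z hZ]

theorem isProj_stickySpace (X W : L2) :
    IsProj (stickySpace X) W ((stickySubmodule X).starProjection W) := by
  set P := (stickySubmodule X).starProjection W
  have hP : P ∈ stickySubmodule X := Submodule.starProjection_apply_mem _ _
  refine ⟨hP, fun Z hZ hne => ?_⟩
  refine lt_of_pow_lt_pow_left₀ 2 (norm_nonneg _) ?_
  have h1 : W - Z = (W - P) - (Z - P) := by abel
  have h2 : 0 < ‖Z - P‖ := norm_pos_iff.2 (sub_ne_zero.2 hne)
  have h3 : inner ℝ (W - P) (Z - P) = 0 :=
    (stickySubmodule X).starProjection_inner_eq_zero W _ ((stickySubmodule X).sub_mem hZ hP)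
  rw [h1, norm_sub_sq_real (W - P), h3]
  nlinarith

end NormalCone

/-! ### Continuity of the interaction term and convexity of `W_Φ`. -/

instance : IsProbabilityMeasure massMeasure := ⟨by simp⟩

theorem norm_step_zero : ‖step 0‖ = 1 := by
  have h : ‖step 0‖ ^ 2 = 1 := by
    rw [← real_inner_self_eq_norm_sq, inner_step_zero, integral_congr_ae step_zero_ae_eq]
    simp
  nlinarith [norm_nonneg (step 0)]

theorem integral_abs_le_norm (Z : L2) : ∫ m, |Z m| ∂massMeasure ≤ ‖Z‖ := by
  have h := real_inner_le_norm |Z| (step 0)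
  rw [norm_step_zero, mul_one, norm_abs_eq_norm, inner_step_zero,
    integral_congr_ae (Lp.coeFn_abs Z)] at h
  exact h

namespace Protocol

variable (p : Protocol)

theorem Phi_zero : p.Phi 0 = 0 := intervalIntegral.integral_same

theorem Phi_sub_Phi (a b : ℝ) : p.Phi b - p.Phi a = ∫ y in a..b, p.φ y :=
  intervalIntegral.integral_interval_sub_left (p.intervalIntegrable _ _) (p.intervalIntegrable _ _)

theorem monotone_Phi : Monotone p.Phi := fun a b hab => by
  have := p.Phi_sub_Phi a b
  have h : 0 ≤ ∫ y in a..b, p.φ y := intervalIntegral.integral_nonneg hab fun u _ => p.nonneg u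
  linarith

/-- Monotonicity gives `φ ≤ φ·1_{(-η,η]} + φ(η)`: the possibly singular core has total mass `2Φ(η)`,
and the remainder is bounded. -/
theorem Phi_sub_le {η a b : ℝ} (hη : 0 < η) (hab : a ≤ b) :
    p.Phi b - p.Phi a ≤ 2 * p.Phi η + p.φ η * (b - a) := by
  have hI : IntegrableOn p.φ (Ioc (-η) η) :=
    (p.intervalIntegrable (-η) η).1
  have hi : Integrable ((Ioc (-η) η).indicator p.φ) := hI.integrable_indicator measurableSet_Ioc
  have hle : ∀ y, p.φ y ≤ (Ioc (-η) η).indicator p.φ y + p.φ η := by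
    intro y
    by_cases hy : y ∈ Ioc (-η) η
    · rw [indicator_of_mem hy]; linarith [p.nonneg η]
    · rw [indicator_of_notMem hy, zero_add]
      by_cases h : η < y
      · exact p.nonincreasing hη (hη.trans h) h.le
      · have h1 : y ≤ -η := not_lt.1 fun h2 => hy ⟨h2, not_lt.1 h⟩
        rw [← p.symmetric y]
        exact p.nonincreasing hη (by simp; linarith) (by linarith)
  calc p.Phi b - p.Phi a = ∫ y in a..b, p.φ y := p.Phi_sub_Phi a b
    _ ≤ ∫ y in a..b, ((Ioc (-η) η).indicator p.φ y + p.φ η) :=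
        intervalIntegral.integral_mono_on hab (p.intervalIntegrable _ _)
          (hi.intervalIntegrable.add (by simp)) fun y _ => hle y
    _ = (∫ y in a..b, (Ioc (-η) η).indicator p.φ y) + p.φ η * (b - a) := by
        rw [intervalIntegral.integral_add hi.intervalIntegrable (by simp)]
        simp [mul_comm]
    _ ≤ 2 * p.Phi η + p.φ η * (b - a) := by
        gcongr
        rw [intervalIntegral.integral_of_le hab]
        refine (setIntegral_le_integral hi (Eventually.of_forall fun y =>
          indicator_nonneg (fun _ _ => p.nonneg _) y)).trans_eq ?_
        rw [integral_indicator measurableSet_Ioc, ← intervalIntegral.integral_of_le (by linarith),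
          ← p.Phi_sub_Phi, p.Phi_neg]
        ring

/-- `Φ` need not be Lipschitz when `φ` is singular at `0`, but `Φ(η) → 0` makes it Lipschitz up to
an arbitrarily small additive error. This suffices for continuity of `conv`. -/
theorem exists_abs_Phi_sub_le {ε : ℝ} (hε : 0 < ε) :
    ∃ C, 0 ≤ C ∧ ∀ a b, |p.Phi b - p.Phi a| ≤ ε + C * |b - a| := by
  have h : ∀ᶠ η in 𝓝[>] (0 : ℝ), p.Phi η < ε / 2 := by
    refine nhdsWithin_le_nhds (p.continuous_Phi.continuousAt.eventually_lt continuousAt_const ?_)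
    rw [p.Phi_zero]; positivity
  obtain ⟨η, h1, hη⟩ := (h.and self_mem_nhdsWithin).exists
  refine ⟨p.φ η, p.nonneg η, fun a b => ?_⟩
  have key : ∀ a b, a ≤ b → |p.Phi b - p.Phi a| ≤ ε + p.φ η * |b - a| := fun a b hab => by
    rw [abs_of_nonneg (sub_nonneg.2 (p.monotone_Phi hab)), abs_of_nonneg (sub_nonneg.2 hab)]
    have := p.Phi_sub_le hη hab
    linarith
  rcases le_total a b with h2 | h2
  · exact key a b h2
  · rw [abs_sub_comm, abs_sub_comm b]; exact key b a h2

theorem integrable_Phi_sub (X : L2) (m : ℝ) :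
    Integrable (fun ω => p.Phi (X m - X ω)) massMeasure := by
  refine Integrable.mono' (g := fun ω => (p.Phi 1 + p.φ 1) * (1 + |X m - X ω|)) ?_ ?_
    (Eventually.of_forall fun ω => p.abs_Phi_le _)
  · exact ((integrable_const _).add
      ((integrable_const (X m)).sub (integrable_coeFn X)).abs).const_mul _
  · exact p.continuous_Phi.comp_aestronglyMeasurable
      (aestronglyMeasurable_const.sub (Lp.aestronglyMeasurable X))

theorem conv_ae_eq (X : L2) :
    p.conv X =ᵐ[massMeasure] fun m => ∫ ω, p.Phi (X m - X ω) ∂massMeasure :=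
  (p.memLp_conv X).coeFn_toLp

theorem norm_conv_sub_le {ε C : ℝ} (hε : 0 < ε) (hC : 0 ≤ C)
    (h : ∀ a b, |p.Phi b - p.Phi a| ≤ ε + C * |b - a|) (X Y : L2) :
    ‖p.conv X - p.conv Y‖ ≤ ε + 2 * C * ‖X - Y‖ := by
  -- A pointwise majorant of the difference: averaging `|X ω - Y ω|` over `ω` costs at most `‖X -
  -- Y‖`.
  set R := (ε + C * ‖X - Y‖) • step 0 + C • |X - Y| with hR
  have hi : Integrable (fun m => |X m - Y m|) massMeasure :=
    ((integrable_coeFn X).sub (integrable_coeFn Y)).abs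
  have hint : ∫ m, |X m - Y m| ∂massMeasure ≤ ‖X - Y‖ := by
    refine le_trans (le_of_eq (integral_congr_ae ?_)) (integral_abs_le_norm (X - Y))
    filter_upwards [Lp.coeFn_sub X Y] with m hm
    rw [hm]; rfl
  have h1 : ‖p.conv X - p.conv Y‖ ≤ ‖R‖ := by
    refine Lp.norm_le_norm_of_ae_le ?_
    filter_upwards [Lp.coeFn_sub (p.conv X) (p.conv Y), p.conv_ae_eq X, p.conv_ae_eq Y,
      Lp.coeFn_add ((ε + C * ‖X - Y‖) • step 0) (C • |X - Y|),
      Lp.coeFn_smul (ε + C * ‖X - Y‖) (step 0), Lp.coeFn_smul C |X - Y|, Lp.coeFn_abs (X - Y),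
      step_zero_ae_eq, Lp.coeFn_sub X Y] with m e1 e2 e3 e4 e5 e6 e7 e8 e9
    rw [hR, e4, Pi.add_apply, e5, e6, Pi.smul_apply, Pi.smul_apply, e7, e8, e9, e1, Pi.sub_apply,
      Pi.sub_apply, e2, e3, ← integral_sub (p.integrable_Phi_sub X m) (p.integrable_Phi_sub Y m)]
    refine (norm_integral_le_of_norm_le (g := fun ω => (ε + C * |X m - Y m|) + C * |X ω - Y ω|)
      ((integrable_const _).add (hi.const_mul C)) (Eventually.of_forall fun ω => ?_)).trans ?_
    · refine (h _ _).trans ?_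
      have h2 : |X m - X ω - (Y m - Y ω)| ≤ |X m - Y m| + |X ω - Y ω| := by
        rw [show X m - X ω - (Y m - Y ω) = (X m - Y m) - (X ω - Y ω) by ring]
        exact abs_sub _ _
      nlinarith [mul_le_mul_of_nonneg_left h2 hC]
    · rw [integral_add (integrable_const _) (hi.const_mul C), integral_const_mul]
      simp only [integral_const, probReal_univ, smul_eq_mul, one_mul, mul_one]
      refine le_trans ?_ (le_abs_self _)
      have := mul_le_mul_of_nonneg_left hint hC
      linarith
  refine h1.trans ((norm_add_le _ _).trans_eq ?_)
  rw [norm_smul, norm_smul, norm_step_zero, norm_abs_eq_norm, Real.norm_eq_abs, Real.norm_eq_abs,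
    abs_of_nonneg hC, abs_of_nonneg (by positivity)]
  ring

theorem continuous_conv : Continuous p.conv := by
  rw [Metric.continuous_iff]
  intro X ε hε
  obtain ⟨C, hC, h⟩ := p.exists_abs_Phi_sub_le (half_pos hε)
  refine ⟨ε / 2 / (2 * C + 1), by positivity, fun Y hY => ?_⟩
  rw [dist_eq_norm] at hY ⊢
  have h1 := p.norm_conv_sub_le (half_pos hε) hC h Y X
  have h2 := (lt_div_iff₀ (by positivity)).1 hY
  nlinarith [norm_nonneg (Y - X)]

/-- Tangent-line inequality: `W` has nondecreasing derivative `Φ`. -/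
theorem W_sub_le (a b : ℝ) : p.W b - p.W a ≤ p.Phi b * (b - a) := by
  have hi : ∀ a b, IntervalIntegrable p.Phi volume a b := fun a b =>
    p.continuous_Phi.intervalIntegrable a b
  have h : p.W b - p.W a = ∫ y in a..b, p.Phi y :=
    intervalIntegral.integral_interval_sub_left (hi _ _) (hi _ _)
  rw [h]
  rcases le_total a b with hab | hab
  · have := intervalIntegral.integral_mono_on hab (hi a b) (by simp : IntervalIntegrable
      (fun _ => p.Phi b) volume a b) fun x hx => p.monotone_Phi hx.2
    simpa [mul_comm] using this
  · have := intervalIntegral.integral_mono_on hab (by simp : IntervalIntegrable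
      (fun _ => p.Phi b) volume b a) (hi b a) fun x hx => p.monotone_Phi hx.1
    rw [intervalIntegral.integral_symm]
    simp only [intervalIntegral.integral_const, smul_eq_mul] at this
    linarith

theorem W_zero : p.W 0 = 0 := intervalIntegral.integral_same

theorem W_nonneg (x : ℝ) : 0 ≤ p.W x := by
  simpa [p.W_zero, p.Phi_zero] using p.W_sub_le x 0

theorem continuous_W : Continuous p.W :=
  intervalIntegral.continuous_primitive (fun a b => p.continuous_Phi.intervalIntegrable a b) 0

theorem memLp_pairSub (X : L2) :
    MemLp (fun z : ℝ × ℝ => X z.1 - X z.2) 2 (massMeasure.prod massMeasure) :=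
  ((Lp.memLp X).comp_fst massMeasure).sub ((Lp.memLp X).comp_snd massMeasure)

theorem memLp_Phi_pairSub (X : L2) :
    MemLp (fun z : ℝ × ℝ => p.Phi (X z.1 - X z.2)) 2 (massMeasure.prod massMeasure) := by
  refine MemLp.mono' (((memLp_const (1 : ℝ)).add (memLp_pairSub X).abs).const_mul
    (p.Phi 1 + p.φ 1)) (p.continuous_Phi.comp_aestronglyMeasurable (memLp_pairSub X).1)
    (Eventually.of_forall fun z => p.abs_Phi_le _)

theorem integrable_W_pairSub (X : L2) :
    Integrable (fun z : ℝ × ℝ => p.W (X z.1 - X z.2)) (massMeasure.prod massMeasure) := by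
  have hi : Integrable (fun z : ℝ × ℝ => p.Phi (X z.1 - X z.2) * (X z.1 - X z.2))
      (massMeasure.prod massMeasure) := (p.memLp_Phi_pairSub X).integrable_mul (memLp_pairSub X)
  refine Integrable.mono' hi (p.continuous_W.comp_aestronglyMeasurable (memLp_pairSub X).1)
    (Eventually.of_forall fun z => ?_)
  rw [Real.norm_eq_abs, abs_of_nonneg (p.W_nonneg _)]
  simpa [p.W_zero] using p.W_sub_le 0 (X z.1 - X z.2)

theorem inner_conv (X E : L2) :
    inner ℝ (p.conv X) E =
      ∫ z : ℝ × ℝ, p.Phi (X z.1 - X z.2) * E z.1 ∂(massMeasure.prod massMeasure) := by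
  have hi : Integrable (fun z : ℝ × ℝ => p.Phi (X z.1 - X z.2) * E z.1)
      (massMeasure.prod massMeasure) :=
    (p.memLp_Phi_pairSub X).integrable_mul ((Lp.memLp E).comp_fst massMeasure)
  rw [integral_prod _ hi, L2.inner_def]
  refine integral_congr_ae ?_
  filter_upwards [p.conv_ae_eq X] with m hm
  simp [hm, integral_mul_const, mul_comm]

/-- Swapping the variables and using that `Φ` is odd; this symmetry absorbs the factor `½` in `𝒱`.
-/
theorem integral_Phi_mul_snd (X E : L2) :
    ∫ z : ℝ × ℝ, p.Phi (X z.1 - X z.2) * E z.2 ∂(massMeasure.prod massMeasure) =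
      - inner ℝ (p.conv X) E := by
  rw [← integral_prod_swap, p.inner_conv, ← integral_neg]
  refine integral_congr_ae (Eventually.of_forall fun z => ?_)
  have := p.Phi_neg (X z.1 - X z.2)
  rw [neg_sub] at this
  simp [this]

end Protocol

/-! ### Gradient of `𝒱` and the resulting normal vectors; properties of `P_{ℋ_X}`. -/

/-- The gradient inequality for the convex functional `𝒱`. -/
theorem potential_sub_le (p : Protocol) (Ψbar X Y : L2) :
    potential p Ψbar Y - potential p Ψbar X ≤ inner ℝ (p.conv Y - Ψbar) (Y - X) := by
  set ν := massMeasure.prod massMeasure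
  have hY := p.integrable_W_pairSub Y
  have hX := p.integrable_W_pairSub X
  have e1 : ∫ m, ∫ ω, p.W (Y m - Y ω) ∂massMeasure ∂massMeasure =
      ∫ z, p.W (Y z.1 - Y z.2) ∂ν := (integral_prod _ hY).symm
  have e2 : ∫ m, ∫ ω, p.W (X m - X ω) ∂massMeasure ∂massMeasure =
      ∫ z, p.W (X z.1 - X z.2) ∂ν := (integral_prod _ hX).symm
  have i1 : Integrable (fun z : ℝ × ℝ => p.Phi (Y z.1 - Y z.2) * (Y - X) z.1) ν :=
    (p.memLp_Phi_pairSub Y).integrable_mul ((Lp.memLp (Y - X)).comp_fst massMeasure)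
  have i2 : Integrable (fun z : ℝ × ℝ => p.Phi (Y z.1 - Y z.2) * (Y - X) z.2) ν :=
    (p.memLp_Phi_pairSub Y).integrable_mul ((Lp.memLp (Y - X)).comp_snd massMeasure)
  have hle : ∫ z, (p.W (Y z.1 - Y z.2) - p.W (X z.1 - X z.2)) ∂ν ≤
      ∫ z, (p.Phi (Y z.1 - Y z.2) * (Y - X) z.1 - p.Phi (Y z.1 - Y z.2) * (Y - X) z.2) ∂ν := by
    refine integral_mono_ae (hY.sub hX) (i1.sub i2) ?_
    have hs := Lp.coeFn_sub Y X
    filter_upwards [Measure.quasiMeasurePreserving_fst.ae hs,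
      Measure.quasiMeasurePreserving_snd.ae hs] with z h1 h2
    rw [h1, h2, Pi.sub_apply, Pi.sub_apply]
    refine (p.W_sub_le _ _).trans_eq ?_
    ring
  rw [integral_sub hY hX, integral_sub i1 i2, ← p.inner_conv, p.integral_Phi_mul_snd] at hle
  simp only [potential]
  rw [e1, e2, inner_sub_left, inner_sub_right Ψbar]
  linarith

/-- The subgradients of `𝒱 + I_𝒦` at a point of `𝒦` split into the gradient of `𝒱` and a normal
vector to `𝒦`. -/
theorem normal_of_neg_mem_subdifferential {p : Protocol} {Ψbar X D : L2} (hX : X ∈ cone)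
    (hD : -D ∈ subdifferential (constrainedPotential p Ψbar) X) {Z : L2} (hZ : Z ∈ cone) :
    inner ℝ (Ψbar - p.conv X - D) (Z - X) ≤ 0 := by
  -- The gradient is taken at the perturbed point, where convexity bounds the increment from above;
  -- letting `h → 0` then needs only continuity of `conv`.
  have key : ∀ h : ℝ, h ∈ Ioc (0 : ℝ) 1 →
      inner ℝ (-D) (Z - X) ≤ inner ℝ (p.conv (X + h • (Z - X)) - Ψbar) (Z - X) := by
    intro h hh
    have hc : X + h • (Z - X) ∈ cone := convex_cone.add_smul_sub_mem hX hZ ⟨hh.1.le, hh.2⟩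
    have h1 := hD (X + h • (Z - X))
    simp only [constrainedPotential, coneIndicator, hX, hc, if_true, add_zero] at h1
    have h2 : potential p Ψbar X + inner ℝ (-D) (X + h • (Z - X) - X) ≤
        potential p Ψbar (X + h • (Z - X)) := by exact_mod_cast h1
    have h3 := potential_sub_le p Ψbar X (X + h • (Z - X))
    rw [add_sub_cancel_left, inner_smul_right] at h2 h3
    exact le_of_mul_le_mul_left (by linarith) hh.1
  have hlim : Tendsto (fun h : ℝ => inner ℝ (p.conv (X + h • (Z - X)) - Ψbar) (Z - X)) (𝓝[>] 0)
      (𝓝 (inner ℝ (p.conv X - Ψbar) (Z - X))) := by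
    have hcont : Continuous fun h : ℝ => inner ℝ (p.conv (X + h • (Z - X)) - Ψbar) (Z - X) := by
      have := p.continuous_conv
      fun_prop
    have := hcont.tendsto 0
    rw [zero_smul, add_zero] at this
    exact this.mono_left nhdsWithin_le_nhds
  have h1 := ge_of_tendsto hlim (by
    filter_upwards [Ioc_mem_nhdsGT zero_lt_one] with h hh using key h hh)
  rw [inner_neg_left, inner_sub_left] at h1
  rw [inner_sub_left, inner_sub_left]
  linarith

/-- The projection `P_{ℋ_X}`. -/
noncomputable def stickyProj (X : L2) : L2 →L[ℝ] L2 := (stickySubmodule X).starProjection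

theorem stickyProj_mem (X W : L2) : stickyProj X W ∈ stickySpace X :=
  Submodule.starProjection_apply_mem (stickySubmodule X) W

theorem stickyProj_eq_self {X U : L2} (hU : U ∈ stickySpace X) : stickyProj X U = U :=
  (Submodule.starProjection_eq_self_iff (K := stickySubmodule X)).2 hU

theorem inner_stickyProj_comm (X U W : L2) :
    inner ℝ (stickyProj X U) W = inner ℝ U (stickyProj X W) :=
  Submodule.inner_starProjection_left_eq_right (stickySubmodule X) U W

theorem inner_sub_stickyProj {X U : L2} (W : L2) (hU : U ∈ stickySpace X) :
    inner ℝ (W - stickyProj X W) U = 0 :=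
  (stickySubmodule X).starProjection_inner_eq_zero W U hU

theorem stickyProj_eq_of_inner {X W P : L2} (hP : P ∈ stickySpace X)
    (h : ∀ U ∈ stickySpace X, inner ℝ (W - P) U = 0) : stickyProj X W = P :=
  (stickySubmodule X).eq_starProjection_of_mem_of_inner_eq_zero hP h

theorem stickyProj_comp {X Y : L2} (h : concentrated X ⊆ concentrated Y) (W : L2) :
    stickyProj Y (stickyProj X W) = stickyProj Y W := by
  refine stickyProj_eq_of_inner (stickyProj_mem Y W) fun U hU => ?_
  have h1 := inner_sub_stickyProj W hU
  have h2 := inner_sub_stickyProj W (stickySubmodule_anti h hU)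
  rw [inner_sub_left] at h1 h2 ⊢
  linarith

theorem norm_sub_stickyProj_le {X U : L2} (W : L2) (hU : U ∈ stickySpace X) :
    ‖W - stickyProj X W‖ ≤ ‖W - U‖ := by
  rcases eq_or_ne U (stickyProj X W) with h | h
  · rw [h]
  · exact ((isProj_stickySpace X W).2 U hU h).le

/-! ### Sticky solutions: right-derivative and transport of normality. -/

section Flow

variable {X : ℝ → L2}

/-- Along a sticky continuous curve, `t ↦ P_{ℋ_{X_t}} W` is right-continuous. -/
theorem tendsto_stickyProj (hmem : ∀ t, 0 ≤ t → X t ∈ cone)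
    (hst : ∀ s t, 0 ≤ s → s ≤ t → concentrated (X s) ⊆ concentrated (X t)) (W : L2) {t : ℝ}
    (ht : 0 ≤ t) (hc : Tendsto X (𝓝[>] t) (𝓝 (X t))) :
    Tendsto (fun r => stickyProj (X r) W) (𝓝[>] t) (𝓝 (stickyProj (X t) W)) := by
  set P := stickyProj (X t) W with hP
  have hPr : ∀ r, t ≤ r → stickyProj (X r) W = stickyProj (X r) P := fun r hr =>
    (stickyProj_comp (hst t r ht hr) W).symm
  set S : Submodule ℝ L2 := ⨆ r : Ioi t, stickySubmodule (X r) with hS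
  have hdir : Directed (· ≤ ·) fun r : Ioi t => stickySubmodule (X r) := fun r r' =>
    ⟨⟨min r r', mem_Ioi.2 (lt_min r.2 r'.2)⟩,
      stickySubmodule_anti (hst _ _ (ht.trans (lt_min r.2 r'.2).le) (min_le_left _ _)),
      stickySubmodule_anti (hst _ _ (ht.trans (lt_min r.2 r'.2).le) (min_le_right _ _))⟩
  -- A vector orthogonal to every `ℋ_{X_r}`, `r > t`, is orthogonal to the truncations of `X_r`,
  -- hence in the limit to those of `X_t`, hence to `ℋ_{X_t}`.
  have hPS : P ∈ S.topologicalClosure := by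
    rw [← Submodule.orthogonal_orthogonal_eq_closure]
    intro Y hY
    have hYr : ∀ r, t < r → ∀ U ∈ stickySpace (X r), inner ℝ Y U = 0 := fun r hr U hU => by
      rw [real_inner_comm]
      exact hY U (le_iSup (fun r : Ioi t => stickySubmodule (X r)) ⟨r, hr⟩ hU)
    have h0 : inner ℝ Y (step 0) = 0 := hYr (t + 1) (by linarith) _
      (step_mem_stickySpace fun h => lt_irrefl _ h.1.1)
    refine inner_eq_zero_of_mem_stickySpace (hmem t ht) h0 (fun α β _ => ?_) (stickyProj_mem _ _)
    have h1 : Tendsto (fun r => inner ℝ Y (rampLp α β (X r))) (𝓝[>] t)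
        (𝓝 (inner ℝ Y (rampLp α β (X t)))) :=
      tendsto_const_nhds.inner (((continuous_rampLp α β).tendsto _).comp hc)
    refine tendsto_nhds_unique h1 (tendsto_const_nhds.congr' ?_)
    filter_upwards [self_mem_nhdsWithin] with r hr
    exact (hYr r hr _ (rampLp_mem_stickySpace α β (hmem r (ht.trans (le_of_lt hr))))).symm
  rw [Metric.tendsto_nhds]
  intro ε hε
  -- The union over `r > t` is directed, so `U` lies in one `ℋ_{X_{r₀}}`, and then in `ℋ_{X_r}` for
  -- all `r ∈ (t, r₀]`; the projection of `P` is at least as close to `P`.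
  obtain ⟨U, hU, hUP⟩ := Metric.mem_closure_iff.1 hPS ε hε
  have : Nonempty (Ioi t) := ⟨⟨t + 1, by simp⟩⟩
  obtain ⟨⟨r₀, hr₀⟩, hUr⟩ := (Submodule.mem_iSup_of_directed _ hdir).1 hU
  filter_upwards [Ioc_mem_nhdsGT hr₀] with r hr
  rw [hPr r hr.1.le, dist_comm, dist_eq_norm]
  have hUr' : U ∈ stickySpace (X r) :=
    stickySubmodule_anti (hst r r₀ (ht.trans hr.1.le) hr.2) hUr
  rw [dist_eq_norm] at hUP
  exact (norm_sub_stickyProj_le P hUr').trans_lt hUP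

/-- The derivative of a sticky curve belongs to `ℋ_{X_t}`. -/
theorem deriv_mem_stickySpace (hmem : ∀ t, 0 ≤ t → X t ∈ cone)
    (hst : ∀ s t, 0 ≤ s → s ≤ t → concentrated (X s) ⊆ concentrated (X t)) {t : ℝ} (ht : 0 ≤ t)
    {D : L2} (hD : HasDerivAt X D t) : D ∈ stickySpace (X t) := by
  have h1 : Tendsto (slope X t) (𝓝[>] t) (𝓝 D) :=
    (hasDerivAt_iff_tendsto_slope.1 hD).mono_left (nhdsWithin_mono _ fun x hx => ne_of_gt hx)
  refine (isClosed_stickySpace (X t)).mem_of_tendsto h1 ?_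
  filter_upwards [self_mem_nhdsWithin] with r hr
  have hr' : t ≤ r := le_of_lt hr
  exact (stickySubmodule (X t)).smul_mem _ ((stickySubmodule (X t)).sub_mem
    (stickySubmodule_anti (hst t r ht hr') (mem_stickySpace_self (hmem r (ht.trans hr'))))
    (mem_stickySpace_self (hmem t ht)))

variable {p : Protocol} {Xbar Vbar : L2}

theorem IsLagrangianSolution.continuousOn (h : IsLagrangianSolution p Xbar Vbar X) :
    ContinuousOn X (Ici 0) := by
  intro t ht
  have h1 := (h.gradientFlow.1 (t + 1) (by linarith [mem_Ici.1 ht])).continuousOn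
  rw [uIcc_of_le (by linarith [mem_Ici.1 ht])] at h1
  refine (h1 t ⟨ht, by linarith⟩).mono_of_mem_nhdsWithin ?_
  rw [← Ici_inter_Iic]
  exact inter_mem self_mem_nhdsWithin (mem_nhdsWithin_of_mem_nhds (Iic_mem_nhds (by linarith)))

theorem IsLagrangianSolution.tendsto_right (h : IsLagrangianSolution p Xbar Vbar X) {t : ℝ}
    (ht : 0 ≤ t) : Tendsto X (𝓝[>] t) (𝓝 (X t)) :=
  (h.continuousOn t ht).mono_left (nhdsWithin_mono _ fun _ hx => ht.trans (le_of_lt hx))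

namespace IsStickyLagrangianSolution

variable (h : IsStickyLagrangianSolution p Xbar Vbar X)
include h

/-- `Ψ̄ = (Φ∗ρ(X_t) + Ẋ_t) + normal vector` is the orthogonal decomposition of `Ψ̄` along `ℋ_{X_t}`.
-/
theorem ae_hasDerivAt : ∀ᵐ t : ℝ, 0 < t →
    HasDerivAt X (stickyProj (X t) (naturalVelocity p Xbar Vbar) - p.conv (X t)) t ∧
    ∀ Z ∈ cone, inner ℝ (naturalVelocity p Xbar Vbar -
      stickyProj (X t) (naturalVelocity p Xbar Vbar)) (Z - X t) ≤ 0 := by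
  filter_upwards [h.gradientFlow.2] with t ht ht0
  obtain ⟨D, hD, hsub⟩ := ht ht0
  have hX := h.mem_cone t ht0.le
  have hnorm := fun Z (hZ : Z ∈ cone) => normal_of_neg_mem_subdifferential hX hsub hZ
  have hDm := deriv_mem_stickySpace h.mem_cone h.sticky ht0.le hD
  have hP : stickyProj (X t) (naturalVelocity p Xbar Vbar) = p.conv (X t) + D := by
    refine stickyProj_eq_of_inner ((stickySubmodule (X t)).add_mem (conv_mem_stickySpace p hX) hDm)
      fun U hU => ?_
    rw [← sub_sub]
    exact inner_eq_zero_of_normal hX hnorm hU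
  rw [hP, ← sub_sub, add_sub_cancel_left]
  exact ⟨hD, hnorm⟩

theorem hasDerivWithinAt {t : ℝ} (ht : 0 ≤ t) :
    HasDerivWithinAt X (stickyProj (X t) (naturalVelocity p Xbar Vbar) - p.conv (X t))
      (Ici t) t := by
  refine AbsolutelyContinuousOnInterval.hasDerivWithinAt_Ici
    (V := fun t => stickyProj (X t) (naturalVelocity p Xbar Vbar) - p.conv (X t)) ht
    h.gradientFlow.1 ?_ ?_
  · filter_upwards [h.ae_hasDerivAt] with r hr hr0 using (hr hr0).1
  · exact (tendsto_stickyProj h.mem_cone h.sticky _ ht (h.tendsto_right ht)).sub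
      ((p.continuous_conv.tendsto _).comp (h.tendsto_right ht))

theorem normal_sub_stickyProj {t : ℝ} (ht : 0 ≤ t) {Z : L2} (hZ : Z ∈ cone) :
    inner ℝ (naturalVelocity p Xbar Vbar -
      stickyProj (X t) (naturalVelocity p Xbar Vbar)) (Z - X t) ≤ 0 := by
  have hlim : Tendsto (fun r => inner ℝ (naturalVelocity p Xbar Vbar -
      stickyProj (X r) (naturalVelocity p Xbar Vbar)) (Z - X r)) (𝓝[>] t)
      (𝓝 (inner ℝ (naturalVelocity p Xbar Vbar -
        stickyProj (X t) (naturalVelocity p Xbar Vbar)) (Z - X t))) :=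
    (tendsto_const_nhds.sub (tendsto_stickyProj h.mem_cone h.sticky _ ht
      (h.tendsto_right ht))).inner (tendsto_const_nhds.sub (h.tendsto_right ht))
  -- The good times have full measure, so they accumulate at `t` from the right, also for `t = 0`.
  refine isClosed_Iic.mem_of_frequently_of_tendsto ?_ hlim
  rw [(nhdsGT_basis t).frequently_iff]
  intro b hb
  obtain ⟨r, hr, hr'⟩ : ∃ r ∈ Ioo t b, 0 < r → inner ℝ (naturalVelocity p Xbar Vbar -
      stickyProj (X r) (naturalVelocity p Xbar Vbar)) (Z - X r) ≤ 0 := by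
    by_contra! hc
    have h1 : volume (Ioo t b) = 0 := by
      refine measure_mono_null (fun x hx => ?_) (ae_iff.1 h.ae_hasDerivAt)
      exact fun hx' => absurd ((hx' (hc x hx).1).2 Z hZ) (not_le.2 (hc x hx).2)
    rw [Real.volume_Ioo] at h1
    simp only [ENNReal.ofReal_eq_zero] at h1
    linarith
  exact ⟨r, hr, hr' (ht.trans_lt hr.1)⟩

/-- `P_{ℋ_{X_s}} Ψ̄ - P_{ℋ_{X_t}} Ψ̄` is normal to `𝒦` at `X_t`. -/
theorem normal_stickyProj_sub {s t : ℝ} (hs : 0 ≤ s) (hst : s ≤ t) {Z : L2} (hZ : Z ∈ cone) :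
    inner ℝ (stickyProj (X s) (naturalVelocity p Xbar Vbar) -
      stickyProj (X t) (naturalVelocity p Xbar Vbar)) (Z - X t) ≤ 0 := by
  have ht := hs.trans hst
  set Ψ := naturalVelocity p Xbar Vbar
  have hXt := h.mem_cone t ht
  have hN := fun Z (hZ : Z ∈ cone) => h.normal_sub_stickyProj ht hZ
  have hsub := stickySubmodule_anti (h.sticky s t hs hst)
  -- `P_t Ψ̄` and `X_t` both lie in `ℋ_{X_s}`, so the difference is the `P_s`-image of a polar
  -- vector, and its pairing with `X_t` is unchanged.
  have e : stickyProj (X s) Ψ - stickyProj (X t) Ψ =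
      stickyProj (X s) (Ψ - stickyProj (X t) Ψ) := by
    rw [map_sub, stickyProj_eq_self (X := X s) (hsub (stickyProj_mem (X t) Ψ))]
  rw [e, inner_sub_right, inner_stickyProj_comm _ _ (X t),
    stickyProj_eq_self (hsub (mem_stickySpace_self hXt)), inner_self_eq_zero_of_normal hXt hN,
    sub_zero]
  exact inner_starProjection_nonpos_of_polar
    (fun Z hZ => inner_nonpos_of_normal hXt hN hZ) hZ

/-- A normal vector to `𝒦` at an earlier time stays normal. -/
theorem normal_mono {s t : ℝ} (hs : 0 ≤ s) (hst : s ≤ t) {Y : L2}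
    (hY : ∀ Z ∈ cone, inner ℝ Y (Z - X s) ≤ 0) {Z : L2} (hZ : Z ∈ cone) :
    inner ℝ Y (Z - X t) ≤ 0 := by
  have hXs := h.mem_cone s hs
  have h1 : inner ℝ Y (X t) = 0 := inner_eq_zero_of_normal hXs hY
    (stickySubmodule_anti (h.sticky s t hs hst) (mem_stickySpace_self (h.mem_cone t (hs.trans hst))))
  rw [inner_sub_right, h1, sub_zero]
  exact inner_nonpos_of_normal hXs hY hZ

theorem intervalIntegrable_conv {s t : ℝ} (hs : 0 ≤ s) (hst : s ≤ t) :
    IntervalIntegrable (fun r => p.conv (X r)) volume s t := by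
  refine ContinuousOn.intervalIntegrable ?_
  rw [uIcc_of_le hst]
  exact p.continuous_conv.comp_continuousOn
    (h.continuousOn.mono fun r hr => hs.trans hr.1)

theorem hasDerivWithinAt_integral_conv {s r : ℝ} (hs : 0 ≤ s) (hr : s ≤ r) :
    HasDerivWithinAt (fun r => ∫ u in s..r, p.conv (X u)) (p.conv (X r)) (Ici r) r := by
  have hc : ContinuousOn (fun r => p.conv (X r)) (Ici 0) :=
    p.continuous_conv.comp_continuousOn h.continuousOn
  have hr0 : Ioi r ⊆ Ici 0 := fun x hx => (hs.trans hr).trans (le_of_lt hx)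
  refine intervalIntegral.integral_hasDerivWithinAt_right (t := Ioi r)
    (h.intervalIntegrable_conv hs hr) ?_
    ((hc r (hs.trans hr)).mono hr0)
  exact ⟨Ioi r, self_mem_nhdsWithin,
    (hc.mono hr0).aestronglyMeasurable measurableSet_Ioi⟩

/-- If `A - P_{ℋ_{X_r}} Ψ̄` is normal to `𝒦` at `X_t` for all `r ∈ [s, t]`, then `X_t` is the
projection of the free evolution from `X_s` with natural velocity `A`. -/
theorem isProj_of_normal {s t : ℝ} (hs : 0 ≤ s) (hst : s ≤ t) {A : L2}
    (hA : ∀ r ∈ Icc s t, ∀ Z ∈ cone,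
      inner ℝ (A - stickyProj (X r) (naturalVelocity p Xbar Vbar)) (Z - X t) ≤ 0) :
    IsProj cone (X s + (t - s) • A - ∫ r in s..t, p.conv (X r)) (X t) := by
  refine isProj_cone (h.mem_cone t (hs.trans hst)) fun Z hZ => ?_
  -- In the gap between free evolution and `X_r` the interaction terms cancel. The pairing starts at
  -- `0` and has nonpositive right-derivative by `hA`.
  have hd : ∀ r ∈ Ico s t, HasDerivWithinAt
      (fun r => inner ℝ (X s + (r - s) • A - (∫ u in s..r, p.conv (X u)) - X r) (Z - X t))
      (inner ℝ (A - stickyProj (X r) (naturalVelocity p Xbar Vbar)) (Z - X t)) (Ici r) r := by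
    intro r hr
    have h1 : HasDerivWithinAt (fun r : ℝ => X s + (r - s) • A) A (Ici r) r := by
      simpa using ((((hasDerivAt_id r).sub_const s).smul_const A).const_add (X s)).hasDerivWithinAt
    have h2 := (h1.sub (h.hasDerivWithinAt_integral_conv hs hr.1)).sub
      (h.hasDerivWithinAt (hs.trans hr.1))
    have h3 := h2.inner ℝ (hasDerivWithinAt_const r (Ici r) (Z - X t))
    rw [inner_zero_right, zero_add, sub_sub_sub_cancel_right] at h3
    exact h3
  have hcont : ContinuousOn
      (fun r => inner ℝ (X s + (r - s) • A - (∫ u in s..r, p.conv (X u)) - X r) (Z - X t))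
      (Icc s t) := by
    have h1 : ContinuousOn (fun r => ∫ u in s..r, p.conv (X u)) (Icc s t) := by
      have := intervalIntegral.continuousOn_primitive_interval
        (f := fun r => p.conv (X r)) (μ := volume) (a := s) (b := t) (by
          rw [uIcc_of_le hst]
          exact (intervalIntegrable_iff_integrableOn_Icc_of_le hst).1
            (h.intervalIntegrable_conv hs hst))
      rwa [uIcc_of_le hst] at this
    have h2 : ContinuousOn X (Icc s t) := h.continuousOn.mono fun r hr => hs.trans hr.1
    have h3 : Continuous fun r : ℝ => X s + (r - s) • A := by fun_prop
    exact ((h3.continuousOn.sub h1).sub h2).inner continuousOn_const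
  have := image_le_of_deriv_right_le_deriv_boundary hcont hd (B := fun _ => 0) (B' := fun _ => 0)
    (by simp) continuousOn_const (fun r _ => hasDerivWithinAt_const _ _ _)
    (fun r hr => hA r (Ico_subset_Icc_self hr) Z hZ) (right_mem_Icc.2 hst)
  exact this

end IsStickyLagrangianSolution

end Flow

end EulerAlignment

/-! ### Assembly of the proposition. -/

open EulerAlignment
theorem mainTheorem7 (p : Protocol) (Xbar Vbar Ψbar : L2) (X V Ψ : ℝ → L2)
    (hXbar : Xbar ∈ cone) (hΨbar : Ψbar = naturalVelocity p Xbar Vbar)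
    (hX : IsStickyLagrangianSolution p Xbar Vbar X)
    (hV : V = velocity X) (hΨ : Ψ = naturalVelocityAt p X) :
    -- the velocity `V t` is a genuine right-derivative, and the time integrals below exist
    (∀ t, 0 ≤ t → HasDerivWithinAt X (V t) (Set.Ici t) t) ∧
    (∀ s t, 0 ≤ s → s ≤ t →
      IntervalIntegrable (fun r => p.conv (X r)) MeasureTheory.volume s t) ∧
    (∀ t, 0 ≤ t → V t ∈ stickySpace (X t) ∧ Ψ t ∈ stickySpace (X t)) ∧
    (∀ s t, 0 ≤ s → s ≤ t →
      Ψ s - Ψ t ∈ subdifferential coneIndicator (X t) ∧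
      IsProj (stickySpace (X t)) (Ψ s) (Ψ t)) ∧
    (∀ s t, 0 ≤ s → s ≤ t →
      IsProj cone (X s + (t - s) • Ψ s - ∫ r in s..t, p.conv (X r)) (X t)) ∧
    (∀ t, 0 ≤ t →
      IsProj (stickySpace (X t)) (prescribedVelocity p Ψbar (X t)) (V t) ∧
      (∃ P, IsProj (stickySpace (X t)) Ψbar P ∧ V t = P - p.conv (X t) ∧ Ψ t = P)) ∧
    (∀ t, 0 ≤ t →
      IsProj cone (Xbar + ∫ s in (0 : ℝ)..t, prescribedVelocity p Ψbar (X s)) (X t) ∧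
      IsProj cone (Xbar + t • Ψbar - ∫ s in (0 : ℝ)..t, p.conv (X s)) (X t)) := by
  have hVt : ∀ t, 0 ≤ t → V t = stickyProj (X t) Ψbar - p.conv (X t) := fun t ht => by
    rw [hV, hΨbar]
    exact (hX.hasDerivWithinAt ht).derivWithin (uniqueDiffOn_Ici t t self_mem_Ici)
  have hΨt : ∀ t, 0 ≤ t → Ψ t = stickyProj (X t) Ψbar := fun t ht => by
    have h1 : Ψ t = V t + p.conv (X t) := by rw [hΨ, hV]; rfl
    rw [h1, hVt t ht, sub_add_cancel]
  have hconv : ∀ t, 0 ≤ t → p.conv (X t) ∈ stickySpace (X t) := fun t ht =>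
    conv_mem_stickySpace p (hX.mem_cone t ht)
  have hfree : ∀ t, 0 ≤ t →
      IsProj cone (Xbar + t • Ψbar - ∫ s in (0 : ℝ)..t, p.conv (X s)) (X t) := fun t ht => by
    have := hX.isProj_of_normal le_rfl ht (A := Ψbar) fun r hr Z hZ =>
      hX.normal_mono hr.1 hr.2 (fun Z hZ => by
        rw [hΨbar]; exact hX.normal_sub_stickyProj hr.1 hZ) hZ
    rwa [hX.initial, sub_zero] at this
  refine ⟨fun t ht => ?_, fun s t hs hst => hX.intervalIntegrable_conv hs hst, fun t ht => ⟨?_, ?_⟩,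
    fun s t hs hst => ⟨?_, ?_⟩, fun s t hs hst => ?_, fun t ht => ⟨?_, ?_⟩, fun t ht =>
    ⟨?_, hfree t ht⟩⟩
  · rw [hVt t ht, hΨbar]
    exact hX.hasDerivWithinAt ht
  · rw [hVt t ht]
    exact (stickySubmodule (X t)).sub_mem (stickyProj_mem _ _) (hconv t ht)
  · rw [hΨt t ht]
    exact stickyProj_mem _ _
  · rw [hΨt s hs, hΨt t (hs.trans hst), hΨbar]
    exact mem_subdifferential_coneIndicator (hX.mem_cone t (hs.trans hst)) fun Z hZ =>
      hX.normal_stickyProj_sub hs hst hZ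
  -- Tower property of nested projections: `P_t Ψ̄ = P_t P_s Ψ̄`.
  · rw [hΨt s hs, hΨt t (hs.trans hst), ← stickyProj_comp (hX.sticky s t hs hst)]
    exact isProj_stickySpace _ _
  -- `Ψ_s - Ψ_r` is normal at `X_r`, and `normal_mono` carries this forward to `X_t`.
  · refine hX.isProj_of_normal hs hst fun r hr Z hZ => ?_
    rw [hΨt s hs, hΨbar]
    exact hX.normal_mono (hs.trans hr.1) hr.2
      (fun Z hZ => hX.normal_stickyProj_sub hs hr.1 hZ) hZ
  · rw [hVt t ht]
    have h1 : stickyProj (X t) (prescribedVelocity p Ψbar (X t)) =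
        stickyProj (X t) Ψbar - p.conv (X t) := by
      rw [prescribedVelocity, map_sub, stickyProj_eq_self (hconv t ht)]
    rw [← h1]
    exact isProj_stickySpace _ _
  · exact ⟨_, isProj_stickySpace _ _, hVt t ht, hΨt t ht⟩
  · have h1 : ∫ s in (0 : ℝ)..t, prescribedVelocity p Ψbar (X s) =
        t • Ψbar - ∫ s in (0 : ℝ)..t, p.conv (X s) := by
      simp only [prescribedVelocity]
      rw [intervalIntegral.integral_sub (by simp) (hX.intervalIntegrable_conv le_rfl ht),
        intervalIntegral.integral_const, sub_zero]
    rw [h1, ← add_sub_assoc]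
    exact hfree t ht
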